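/- Let $\mathbb K=\mathbb R$ or $\mathbb C$. For a Hermitian (symmetric if $\mathbb K=\mathbb R$) $n\times n$ matrix $M$ write $\lambda_1(M)\ge\cdots\ge\lambda_n(M)$ for its ordered eigenvalues. On a common probability space, for each $n$ let $X_n$ be a random Hermitian $n\times n$ matrix over $\mathbb K$. Assume that almost surely the empirical eigenvalue distributions $\mu_{X_n}=\frac1n\sum_{j=1}^n\delta_{\lambda_j(X_n)}$ converge weakly to a non-random compactly supported probability measure $\mu_X$ on $\mathbb R$, and that almost surely $\lambda_n(X_n)\to a$ and $\lambda_1(X_n)\to b$, where $a$ and $b$ are the infimum and the supremum of the support of $\mu_X$. Let $r\ge1$ and let $\theta_1\ge\cdots\ge\theta_r$ be non-zero real numbers not depending on $n$. For each $n\ge r$ let $P_n$ be a random Hermitian $n\times n$ matrix over $\mathbb K$ of rank $r$ whose non-zero eigenvalues, counted with multiplicity, are almost surely $\theta_1,\dots,\theta_r$. Assume that for each $n\ge r$ the matrices $X_n$ and $P_n$ are independent and that the law of $X_n$ or the law of $P_n$ is invariant under conjugation by every orthogonal (if $\mathbb K=\mathbb R$) or unitary (if $\mathbb K=\mathbb C$)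 matrix. Put $\widetilde X_n=X_n+P_n$. Let $G_{\mu_X}(z)=\int\frac{d\mu_X(t)}{z-t}$ be the Cauchy transform, and let $G_{\mu_X}(a^-)=\lim_{z\uparrow a}G_{\mu_X}(z)\in[-\infty,0)$ and $G_{\mu_X}(b^+)=\lim_{z\downarrow b}G_{\mu_X}(z)\in(0,+\infty]$. Let $i_0\in\{1,\dots,r\}$ be such that $1/\theta_{i_0}\in(G_{\mu_X}(a^-),G_{\mu_X}(b^+))$. For $n\ge r$ put $\widetilde\lambda_{i_0}=\lambda_{i_0}(\widetilde X_n)$ if $\theta_{i_0}>0$ and $\widetilde\lambda_{i_0}=\lambda_{n-r+i_0}(\widetilde X_n)$ if $\theta_{i_0}<0$, and let $\widetilde u=\widetilde u^{(n)}$ be any unit-norm eigenvector of $\widetilde X_n$ associated with $\widetilde\lambda_{i_0}$. For a subspace $F$ of $\mathbb K^n$ let $\langle x,F\rangle$ denote the norm of the orthogonal projection of $x$ onto $F$. Then there is exactly one $\rho\in\mathbb R\setminus[a,b]$ with $G_{\mu_X}(\rho)=1/\theta_{i_0}$; the function $G_{\mu_X}$ is differentiable at $\rho$ with $G_{\mu_X}'(\rho)\neq0$;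 almost surely $\widetilde\lambda_{i_0}\to\rho$; and, as $n\to\infty$, (a) $\displaystyle \langle\widetilde u,\ker(\theta_{i_0}I_n-P_n)\rangle^2\longrightarrow\frac{-1}{\theta_{i_0}^2\,G_{\mu_X}'(\rho)}$ almost surely; (b) $\displaystyle \Big\langle\widetilde u,\ \bigoplus_{\theta\in\{\theta_1,\dots,\theta_r\}\setminus\{\theta_{i_0}\}}\ker(\theta I_n-P_n)\Big\rangle\longrightarrow0$ almost surely. -/

import Mathlib

open MeasureTheory ProbabilityTheory Filter Topology
open scoped BoundedContinuousFunction

noncomputable section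

namespace SpikedModel

/-- `lam hA k` is the `k`-th largest eigenvalue `λ_k(A)` of a Hermitian `n × n` matrix, counted with
multiplicity, for `1 ≤ k ≤ n` (so `λ_1(A) ≥ ⋯ ≥ λ_n(A)`); it is `0` for other `k`. -/
def lam {𝕜 : Type*} [RCLike 𝕜] {n : ℕ} {A : Matrix (Fin n) (Fin n) 𝕜} (hA : A.IsHermitian)
    (k : ℕ) : ℝ :=
  if h : 1 ≤ k ∧ k ≤ n then hA.eigenvalues₀ ⟨k - 1, by rw [Fintype.card_fin]; omega⟩ else 0

/-- The empirical eigenvalue distribution `(1/n) ∑_j δ_{λ_j(A)}`. -/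
def empiricalSpectral {𝕜 : Type*} [RCLike 𝕜] {n : ℕ} {A : Matrix (Fin n) (Fin n) 𝕜}
    (hA : A.IsHermitian) : Measure ℝ :=
  (n : ENNReal)⁻¹ • ∑ j ∈ Finset.Icc 1 n, Measure.dirac (lam hA j)

/-- Weak convergence of a sequence of finite measures on the line. -/
def WeaklyConverges (ν : ℕ → Measure ℝ) (μ : Measure ℝ) : Prop :=
  ∀ f : ℝ →ᵇ ℝ, Tendsto (fun n => ∫ t, f t ∂(ν n)) atTop (𝓝 (∫ t, f t ∂μ))

/-- Infimum of the support. -/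
def edgeInf (μ : Measure ℝ) : ℝ := sInf μ.support

/-- Supremum of the support. -/
def edgeSup (μ : Measure ℝ) : ℝ := sSup μ.support

/-- The Cauchy transform at real points (meaningful off the support). -/
def cauchyG (μ : Measure ℝ) (z : ℝ) : ℝ := ∫ t, 1 / (z - t) ∂μ

/-- `G_μ(a⁻)`, in the extended reals, with `a` the infimum of the support. -/
def cauchyAtInf (μ : Measure ℝ) : EReal :=
  Function.leftLim (fun z => (cauchyG μ z : EReal)) (edgeInf μ)

/-- `G_μ(b⁺)`, in the extended reals, with `b` the supremum of the support. -/
def cauchyAtSup (μ : Measure ℝ) : EReal :=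
  Function.rightLim (fun z => (cauchyG μ z : EReal)) (edgeSup μ)

/-- Matrices carry the product σ-algebra of their entries (the Borel one). -/
instance matrixMeasurableSpace {m n α : Type*} [MeasurableSpace α] :
    MeasurableSpace (Matrix m n α) :=
  inferInstanceAs (MeasurableSpace (m → n → α))

/-- The law of the random matrix `Y` is invariant under conjugation by the orthogonal group
(`𝕜 = ℝ`) or the unitary group (`𝕜 = ℂ`). -/
def ConjInvariant {𝕜 : Type*} [RCLike 𝕜] {n : ℕ} {Ω : Type*} [MeasurableSpace Ω] (Pr : Measure Ω)
    (Y : Ω → Matrix (Fin n) (Fin n) 𝕜) : Prop :=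
  ∀ U ∈ Matrix.unitaryGroup (Fin n) 𝕜, Pr.map (fun ω => U * Y ω * star U) = Pr.map Y

/-- The nonzero eigenvalues of `A`, counted with multiplicity, are exactly `θ_1, …, θ_r`
(for nonzero `θ_i` this forces `A` to have rank `r`). -/
def NonzeroEigenvaluesAre {𝕜 : Type*} [RCLike 𝕜] {n r : ℕ} {A : Matrix (Fin n) (Fin n) 𝕜}
    (hA : A.IsHermitian) (θ : Fin r → ℝ) : Prop :=
  (Finset.univ.val.map hA.eigenvalues).filter (fun x => x ≠ 0) = Finset.univ.val.map θ

/-- `ker (t I - A)` as a subspace of `𝕜ⁿ` with its standard inner product. -/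
def eigKer {𝕜 : Type*} [RCLike 𝕜] {n : ℕ} (A : Matrix (Fin n) (Fin n) 𝕜) (t : ℝ) :
    Submodule 𝕜 (EuclideanSpace 𝕜 (Fin n)) :=
  LinearMap.ker (Matrix.toEuclideanLin ((t : 𝕜) • (1 : Matrix (Fin n) (Fin n) 𝕜) - A))

/-- `⟨x, F⟩`: the norm of the orthogonal projection of `x` onto the subspace `F`. -/
def projNorm {𝕜 : Type*} [RCLike 𝕜] {n : ℕ} (x : EuclideanSpace 𝕜 (Fin n))
    (F : Submodule 𝕜 (EuclideanSpace 𝕜 (Fin n))) : ℝ :=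
  ‖F.starProjection x‖

/-- The (1-based) position in the ordered spectrum of an `n × n` matrix of the outlier that
corresponds to `θ_i`: position `i` if `θ_i > 0`, and `n - r + i` if `θ_i < 0`. Here `i : Fin r`
is 0-based, so `i + 1` is the 1-based index. -/
def outlierPos (n : ℕ) {r : ℕ} (θ : Fin r → ℝ) (i : Fin r) : ℕ :=
  if 0 < θ i then (i : ℕ) + 1 else n - r + ((i : ℕ) + 1)

end SpikedModel

end

/-!
Let `R = (ρ - X)⁻¹`, and let `v_i` be the eigenvectors of the perturbation `P = ∑ θ_i v_i v_i*`.

Conjugation invariance lets `X` be replaced by `U X U*` with `U` Haar distributed and independent of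
`X` and `P`. By invariance of Haar measure, the fourth moment of the quadratic form of `U X U*` at a
fixed vector equals its average over sign vectors rescaled to the same length, where a Rademacher
chaos bound applies. So the fourth moments of the compression of a centered, normalized Hermitian
matrix to the range of `P` are `O(n⁻²)`, and Borel-Cantelli gives, almost surely,
`⟨v_i, R^k v_j⟩ → δ_ij ∫ (ρ - t)⁻ᵏ dμ(t)`. Everything else is deterministic along such a
realization.

Write `g = G(z)`. The vectors `g⁻¹ (z - X)⁻¹ v_j` are asymptotically dual to the `v_j`, so that on
their span the form of `g (X + P - z)` approaches a diagonal one with entries `g θ_j - 1`. With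
Courant-Fischer this counts the eigenvalues of `X + P` beyond `z`, and the outlier can only sit
where `G(ρ) = 1 / θ_{i₀}`.

If `u` is a unit eigenvector for an eigenvalue `w → ρ`, then `u = R P u + (ρ - w) R u` is close to
`∑ θ_j ⟨v_j, u⟩ R v_j`. Pairing with `v_i` gives `(1 - θ_i G(ρ)) ⟨v_i, u⟩ → 0`, which kills the
components with `θ_i ≠ θ_{i₀}`, and taking norms gives `-G'(ρ) ∑ θ_j² |⟨v_j, u⟩|² → 1`.
-/

noncomputable section

namespace SpikedModel

section Signs

variable {ι : Type*} [DecidableEq ι] {s : Finset ι} {a : ι}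

/-- The sign vector that is `1` on `t` and `-1` off `t`. Averages over independent Rademacher signs
indexed by `s` are written as sums over `t ∈ s.powerset`. -/
def signVec (t : Finset ι) (i : ι) : ℝ := if i ∈ t then 1 else -1

theorem sum_powerset_insert_signVec (ha : a ∉ s) (F : (ι → ℝ) → ℝ) :
    ∑ t ∈ (insert a s).powerset, F (signVec t) =
      ∑ t ∈ s.powerset, (F (Function.update (signVec t) a 1) +
        F (Function.update (signVec t) a (-1))) := by
  rw [Finset.sum_powerset_insert ha, add_comm, ← Finset.sum_add_distrib]
  refine Finset.sum_congr rfl fun t ht => ?_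
  have hat : a ∉ t := fun h => ha (Finset.mem_powerset.1 ht h)
  congr 2 <;> funext i <;> by_cases hi : i = a <;> simp [signVec, hi, hat]

theorem sum_insert_mul_update (ha : a ∉ s) (b x : ι → ℝ) (e : ℝ) :
    ∑ i ∈ insert a s, b i * Function.update x a e i = e * b a + ∑ i ∈ s, b i * x i := by
  rw [Finset.sum_insert ha, Function.update_self, mul_comm]
  congr 1
  exact Finset.sum_congr rfl fun i hi => by
    rw [Function.update_of_ne (ne_of_mem_of_not_mem hi ha)]

theorem sum_powerset_linear_sq (s : Finset ι) (b : ι → ℝ) :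
    ∑ t ∈ s.powerset, (∑ i ∈ s, b i * signVec t i) ^ 2 = 2 ^ s.card * ∑ i ∈ s, b i ^ 2 := by
  induction s using Finset.induction_on with
  | empty => simp
  | insert a s ha ih =>
    rw [sum_powerset_insert_signVec ha fun x => (∑ i ∈ insert a s, b i * x i) ^ 2]
    simp only [sum_insert_mul_update ha]
    rw [Finset.sum_congr rfl fun t _ => show _ = 2 * (∑ i ∈ s, b i * signVec t i) ^ 2
      + 2 * b a ^ 2 by ring, Finset.sum_add_distrib, ← Finset.mul_sum, ih, Finset.sum_const,
      Finset.card_powerset, Finset.sum_insert ha, Finset.card_insert_of_notMem ha, nsmul_eq_mul]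
    push_cast
    ring

theorem sum_powerset_linear_pow_four_le (s : Finset ι) (b : ι → ℝ) :
    ∑ t ∈ s.powerset, (∑ i ∈ s, b i * signVec t i) ^ 4 ≤
      2 ^ s.card * (3 * (∑ i ∈ s, b i ^ 2) ^ 2) := by
  induction s using Finset.induction_on with
  | empty => simp
  | insert a s ha ih =>
    rw [sum_powerset_insert_signVec ha fun x => (∑ i ∈ insert a s, b i * x i) ^ 4]
    simp only [sum_insert_mul_update ha]
    rw [Finset.sum_congr rfl fun t _ => show _ = 2 * (∑ i ∈ s, b i * signVec t i) ^ 4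
      + (12 * b a ^ 2 * (∑ i ∈ s, b i * signVec t i) ^ 2 + 2 * b a ^ 4) by ring,
      Finset.sum_add_distrib, Finset.sum_add_distrib, ← Finset.mul_sum, ← Finset.mul_sum,
      sum_powerset_linear_sq, Finset.sum_const,
      Finset.card_powerset, Finset.sum_insert ha, Finset.card_insert_of_notMem ha, nsmul_eq_mul]
    push_cast
    have : (0 : ℝ) ≤ 2 ^ s.card * b a ^ 4 := by positivity
    linear_combination 2 * ih + 4 * this

/-- The off-diagonal part of a quadratic form, evaluated at a sign vector `x`: then the diagonal
terms contribute `B i i`. -/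
def chaos (s : Finset ι) (B : ι → ι → ℝ) (x : ι → ℝ) : ℝ :=
  ∑ i ∈ s, ∑ j ∈ s, B i j * x i * x j - ∑ i ∈ s, B i i

theorem chaos_insert_update (ha : a ∉ s) (B : ι → ι → ℝ) (x : ι → ℝ) {e : ℝ} (he : e * e = 1) :
    chaos (insert a s) B (Function.update x a e) =
      e * ∑ i ∈ s, (B a i + B i a) * x i + chaos s B x := by
  have hcol (i : ι) : ∑ j ∈ insert a s, B i j * Function.update x a e i * Function.update x a e j
      = Function.update x a e i * (e * B i a + ∑ j ∈ s, B i j * x j) := by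
    rw [← sum_insert_mul_update ha (B i), Finset.mul_sum]
    exact Finset.sum_congr rfl fun _ _ => by ring
  have hrows : ∑ i ∈ s, Function.update x a e i * (e * B i a + ∑ j ∈ s, B i j * x j) =
      e * ∑ i ∈ s, B i a * x i + ∑ i ∈ s, ∑ j ∈ s, B i j * x i * x j := by
    rw [Finset.mul_sum, ← Finset.sum_add_distrib]
    refine Finset.sum_congr rfl fun i hi => ?_
    rw [Function.update_of_ne (ne_of_mem_of_not_mem hi ha), mul_add, Finset.mul_sum]
    congr 1
    · ring
    · exact Finset.sum_congr rfl fun _ _ => by ring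
  simp only [chaos, hcol, Finset.sum_insert ha, Function.update_self, hrows, add_mul,
    Finset.sum_add_distrib]
  linear_combination B a a * he

theorem sum_powerset_insert_chaos_pow_four (ha : a ∉ s) (B : ι → ι → ℝ) :
    ∑ t ∈ (insert a s).powerset, chaos (insert a s) B (signVec t) ^ 4 =
      2 * ∑ t ∈ s.powerset, chaos s B (signVec t) ^ 4 +
        12 * ∑ t ∈ s.powerset,
          chaos s B (signVec t) ^ 2 * (∑ i ∈ s, (B a i + B i a) * signVec t i) ^ 2 +
        2 * ∑ t ∈ s.powerset, (∑ i ∈ s, (B a i + B i a) * signVec t i) ^ 4 := by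
  rw [sum_powerset_insert_signVec ha fun x => chaos (insert a s) B x ^ 4]
  rw [Finset.mul_sum, Finset.mul_sum, Finset.mul_sum, ← Finset.sum_add_distrib,
    ← Finset.sum_add_distrib]
  refine Finset.sum_congr rfl fun t _ => ?_
  rw [chaos_insert_update ha B _ (one_mul 1), chaos_insert_update ha B _ (by norm_num)]
  ring

theorem sum_powerset_chaos_pow_four_le (s : Finset ι) (B : ι → ι → ℝ) :
    ∑ t ∈ s.powerset, chaos s B (signVec t) ^ 4 ≤
      2 ^ s.card * (108 * (∑ i ∈ s, ∑ j ∈ s, B i j ^ 2) ^ 2) := by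
  induction s using Finset.induction_on with
  | empty => simp [chaos]
  | insert a s ha ih =>
    set b : ι → ℝ := fun i => B a i + B i a
    set Q : Finset ι → ℝ := fun t => chaos s B (signVec t)
    set L : Finset ι → ℝ := fun t => ∑ i ∈ s, b i * signVec t i
    set M : ℝ := ∑ i ∈ s, ∑ j ∈ s, B i j ^ 2
    set l : ℝ := ∑ i ∈ s, b i ^ 2
    have hL : ∑ t ∈ s.powerset, L t ^ 4 ≤ 2 ^ s.card * (3 * l ^ 2) :=
      sum_powerset_linear_pow_four_le s b
    have : 0 ≤ M := by positivity
    have : 0 ≤ l := by positivity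
    have hcross : ∑ t ∈ s.powerset, Q t ^ 2 * L t ^ 2 ≤ 2 ^ s.card * (18 * (M * l)) := by
      refine abs_le_of_sq_le_sq' ?_ (by positivity) |>.2
      calc (∑ t ∈ s.powerset, Q t ^ 2 * L t ^ 2) ^ 2
          ≤ (∑ t ∈ s.powerset, (Q t ^ 2) ^ 2) * ∑ t ∈ s.powerset, (L t ^ 2) ^ 2 :=
            Finset.sum_mul_sq_le_sq_mul_sq _ _ _
        _ = (∑ t ∈ s.powerset, Q t ^ 4) * ∑ t ∈ s.powerset, L t ^ 4 := by simp only [← pow_mul]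
        _ ≤ (2 ^ s.card * (108 * M ^ 2)) * (2 ^ s.card * (3 * l ^ 2)) := by gcongr
        _ = _ := by ring
    have hnew : M + l / 2 ≤ ∑ i ∈ insert a s, ∑ j ∈ insert a s, B i j ^ 2 := by
      have hl' : l ≤ 2 * (∑ i ∈ s, B a i ^ 2 + ∑ i ∈ s, B i a ^ 2) := by
        rw [← Finset.sum_add_distrib, Finset.mul_sum]
        exact Finset.sum_le_sum fun i _ => add_sq_le
      simp only [Finset.sum_insert ha, Finset.sum_add_distrib]
      linarith [sq_nonneg (B a a)]
    calc _ ≤ 2 * (2 ^ s.card * (108 * M ^ 2)) + 12 * (2 ^ s.card * (18 * (M * l)))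
          + 2 * (2 ^ s.card * (3 * l ^ 2)) := by
          rw [sum_powerset_insert_chaos_pow_four ha]
          gcongr
      _ ≤ 2 ^ (s.card + 1) * (108 * (M + l / 2) ^ 2) := by
        have : 0 ≤ 2 ^ s.card * l ^ 2 := by positivity
        rw [pow_succ]
        linear_combination 48 * this
      _ ≤ _ := by rw [Finset.card_insert_of_notMem ha]; gcongr

end Signs

open Matrix
open scoped Matrix.Norms.Frobenius InnerProductSpace

section Haar

instance {𝕜 ι : Type*} [RCLike 𝕜] [Finite ι] : BorelSpace (Matrix ι ι 𝕜) :=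
  inferInstanceAs (BorelSpace (ι → ι → 𝕜))

instance {𝕜 ι : Type*} [RCLike 𝕜] [Finite ι] : SecondCountableTopology (Matrix ι ι 𝕜) :=
  inferInstanceAs (SecondCountableTopology (ι → ι → 𝕜))

variable {𝕜 ι : Type*} [RCLike 𝕜] [Fintype ι] [DecidableEq ι]

local notation "Ad" => Unitary.conjStarAlgAut 𝕜 (Matrix ι ι 𝕜)

instance : BorelSpace (unitaryGroup ι 𝕜) := Subtype.borelSpace _

instance : SecondCountableTopology (unitaryGroup ι 𝕜) :=
  TopologicalSpace.Subtype.secondCountableTopology _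

instance : CompactSpace (unitaryGroup ι 𝕜) := by
  refine isCompact_iff_compactSpace.mp ?_
  have hK : IsCompact (Set.pi Set.univ fun _ : ι => Set.pi Set.univ fun _ : ι =>
      Metric.closedBall (0 : 𝕜) 1) :=
    isCompact_univ_pi fun _ => isCompact_univ_pi fun _ => isCompact_closedBall _ _
  refine hK.of_isClosed_subset (isClosed_unitary (R := Matrix ι ι 𝕜)) fun U hU i _ j _ => ?_
  simpa using entry_norm_bound_of_unitary hU i j

variable (𝕜 ι) in
/-- The Haar probability measure on the orthogonal group (`𝕜 = ℝ`) or the unitary group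
(`𝕜 = ℂ`), along which the fourth moments below are averaged. -/
def haarUnitary : Measure (unitaryGroup ι 𝕜) := Measure.haarMeasure ⊤

instance : IsProbabilityMeasure (haarUnitary 𝕜 ι) :=
  ⟨by simpa [haarUnitary] using Measure.haarMeasure_self (K₀ :=
    (⊤ : TopologicalSpace.PositiveCompacts (unitaryGroup ι 𝕜)))⟩

instance : (haarUnitary 𝕜 ι).IsMulLeftInvariant := by unfold haarUnitary; infer_instance

theorem integrable_haarUnitary {f : unitaryGroup ι 𝕜 → ℝ} (hf : Continuous f) :
    Integrable f (haarUnitary 𝕜 ι) :=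
  hf.integrable_of_hasCompactSupport (HasCompactSupport.of_compactSpace f)

theorem frobenius_norm_sq (M : Matrix ι ι 𝕜) : ‖M‖ ^ 2 = ∑ i, ∑ j, ‖M i j‖ ^ 2 := by
  rw [frobenius_norm_def, ← Real.sqrt_eq_rpow, Real.sq_sqrt (by positivity)]
  simp only [Real.rpow_two]

theorem frobenius_norm_sq_eq_trace (M : Matrix ι ι 𝕜) :
    ((‖M‖ ^ 2 : ℝ) : 𝕜) = (M * star M).trace := by
  simp [frobenius_norm_sq, trace, Matrix.mul_apply, star_apply, RCLike.mul_conj]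

theorem trace_conj (U : unitaryGroup ι 𝕜) (A : Matrix ι ι 𝕜) : (Ad U A).trace = A.trace := by
  rw [Unitary.conjStarAlgAut_apply, trace_mul_cycle, Unitary.coe_star_mul_self, one_mul]

theorem frobenius_norm_conj (U : unitaryGroup ι 𝕜) (A : Matrix ι ι 𝕜) : ‖Ad U A‖ = ‖A‖ := by
  rw [← sq_eq_sq₀ (norm_nonneg _) (norm_nonneg _)]
  apply RCLike.ofReal_injective (K := 𝕜)
  rw [frobenius_norm_sq_eq_trace, frobenius_norm_sq_eq_trace, ← map_star, ← map_mul, trace_conj]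

/-- The matrix `A` minus its normalized trace. -/
def centered (A : Matrix ι ι 𝕜) : Matrix ι ι 𝕜 :=
  A - (A.trace / (Fintype.card ι : 𝕜)) • (1 : Matrix ι ι 𝕜)

theorem continuous_centered : Continuous (centered : Matrix ι ι 𝕜 → Matrix ι ι 𝕜) := by
  unfold centered
  fun_prop

theorem centered_conj (U : unitaryGroup ι 𝕜) (A : Matrix ι ι 𝕜) :
    centered (Ad U A) = Ad U (centered A) := by
  rw [centered, centered, trace_conj, map_sub, map_smul, map_one]

theorem isHermitian_centered {A : Matrix ι ι 𝕜} (hA : A.IsHermitian) :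
    (centered A).IsHermitian := by
  refine hA.sub (IsSelfAdjoint.smul ?_ (IsSelfAdjoint.one _))
  have htrace : star A.trace = A.trace := by rw [← trace_conjTranspose, hA.eq]
  rw [isSelfAdjoint_iff, star_div₀, star_natCast, htrace]

theorem trace_centered [Nonempty ι] (A : Matrix ι ι 𝕜) : (centered A).trace = 0 := by
  simp [centered]

theorem frobenius_norm_centered_le (A : Matrix ι ι 𝕜) : ‖centered A‖ ≤ ‖A‖ := by
  rcases isEmpty_or_nonempty ι with _ | _
  · rw [Subsingleton.elim (centered A) A]
  have hcard : (Fintype.card ι : 𝕜) ≠ 0 := by simp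
  have hdiff : ‖A‖ ^ 2 - ‖centered A‖ ^ 2 = ‖A.trace‖ ^ 2 / Fintype.card ι := by
    apply RCLike.ofReal_injective (K := 𝕜)
    rw [RCLike.ofReal_sub, frobenius_norm_sq_eq_trace, frobenius_norm_sq_eq_trace]
    have hstar : (star A).trace = star A.trace := trace_conjTranspose A
    simp only [centered, sub_mul, mul_sub, star_sub, star_smul, trace_sub, trace_smul, trace_one,
      star_one, mul_one, one_mul, Matrix.mul_smul, Matrix.smul_mul, smul_eq_mul, star_div₀, hstar,
      star_natCast]
    push_cast
    rw [← RCLike.mul_conj]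
    field_simp
    simp
  refine abs_le_of_sq_le_sq' (sub_nonneg.1 ?_) (norm_nonneg _) |>.2
  rw [hdiff]
  positivity

theorem exists_linearIsometryEquiv_apply_eq {E : Type*} [NormedAddCommGroup E]
    [InnerProductSpace 𝕜 E] [FiniteDimensional 𝕜 E] {x y : E} (h : ‖x‖ = ‖y‖) :
    ∃ e : E ≃ₗᵢ[𝕜] E, e x = y := by
  by_cases hx : x = 0
  · exact ⟨.refl 𝕜 E, by rw [hx, norm_zero, eq_comm, norm_eq_zero] at h; simp [hx, h]⟩
  have hunit {z : E} (hz : ‖z‖ = ‖x‖) : ‖((‖x‖⁻¹ : ℝ) : 𝕜) • z‖ = 1 := by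
    rw [norm_smul, hz, RCLike.norm_ofReal, abs_inv, abs_norm, inv_mul_cancel₀ (by simpa using hx)]
  have hne : ((‖x‖⁻¹ : ℝ) : 𝕜) ≠ 0 := by simpa using hx
  set x' := ((‖x‖⁻¹ : ℝ) : 𝕜) • x
  let L : (𝕜 ∙ x') →ₗᵢ[𝕜] E := (LinearIsometry.toSpanSingleton 𝕜 E (hunit h.symm)).comp
    (LinearIsometryEquiv.toSpanUnitSingleton x' (hunit rfl)).symm.toLinearIsometry
  refine ⟨L.extend.toLinearIsometryEquiv rfl, smul_right_injective E hne ?_⟩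
  have hx' : x' ∈ 𝕜 ∙ x' := Submodule.mem_span_singleton_self x'
  calc _ = L.extend x' := (map_smul L.extend _ _).symm
    _ = L ⟨x', hx'⟩ := LinearIsometry.extend_apply L ⟨x', hx'⟩
    _ = _ := by
      have : (LinearIsometryEquiv.toSpanUnitSingleton x' (hunit rfl)).symm ⟨x', hx'⟩ = (1 : 𝕜) :=
        (LinearIsometryEquiv.symm_apply_eq _).2 (Subtype.ext (by simp))
      simp [L, this]

theorem exists_unitary_apply_eq {x y : EuclideanSpace 𝕜 ι} (h : ‖x‖ = ‖y‖) :
    ∃ V : unitaryGroup ι 𝕜, toEuclideanCLM (𝕜 := 𝕜) (V : Matrix ι ι 𝕜) x = y := by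
  obtain ⟨e, he⟩ := exists_linearIsometryEquiv_apply_eq (𝕜 := 𝕜) h
  let W := Unitary.linearIsometryEquiv.symm e
  refine ⟨⟨(toEuclideanCLM (n := ι) (𝕜 := 𝕜)).symm W, Unitary.map_mem _ W.2⟩, ?_⟩
  rw [StarAlgEquiv.apply_symm_apply]
  exact he

/-- The quadratic form `x ↦ re ⟨x, M x⟩`. -/
def reForm (M : Matrix ι ι 𝕜) (x : EuclideanSpace 𝕜 ι) : ℝ :=
  RCLike.re ⟪x, toEuclideanCLM (𝕜 := 𝕜) M x⟫_𝕜

theorem reForm_eq_sum (M : Matrix ι ι 𝕜) (x : EuclideanSpace 𝕜 ι) :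
    reForm M x = ∑ i, ∑ j, RCLike.re (star (x i) * M i j * x j) := by
  simp only [reForm, PiLp.inner_apply, ofLp_toEuclideanCLM, mulVec, dotProduct, map_sum,
    RCLike.inner_apply', Finset.mul_sum, mul_assoc]
  rfl

theorem continuous_reForm (x : EuclideanSpace 𝕜 ι) :
    Continuous fun M : Matrix ι ι 𝕜 => reForm M x := by
  simp only [reForm_eq_sum]
  fun_prop

theorem reForm_conj (V : unitaryGroup ι 𝕜) (M : Matrix ι ι 𝕜) (x : EuclideanSpace 𝕜 ι) :
    reForm (Ad (star V) M) x = reForm M (toEuclideanCLM (𝕜 := 𝕜) (V : Matrix ι ι 𝕜) x) := by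
  rw [reForm, reForm, Unitary.conjStarAlgAut_apply, Unitary.coe_star, star_star, map_mul, map_mul,
    map_star, mul_apply_eq_comp, mul_apply_eq_comp,
    ContinuousLinearMap.star_eq_adjoint, ContinuousLinearMap.adjoint_inner_right]

theorem reForm_smul (M : Matrix ι ι 𝕜) (c : ℝ) (x : EuclideanSpace 𝕜 ι) :
    reForm M ((c : 𝕜) • x) = c ^ 2 * reForm M x := by
  simp only [reForm, map_smul, inner_smul_left, inner_smul_right, RCLike.conj_ofReal,
    RCLike.re_ofReal_mul]
  ring

theorem sum_reForm_signVec_pow_four_le {M : Matrix ι ι 𝕜} (hM : M.trace = 0) :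
    ∑ t : Finset ι, reForm M (WithLp.toLp 2 fun i => (signVec t i : 𝕜)) ^ 4 ≤
      2 ^ Fintype.card ι * (108 * ‖M‖ ^ 4) := by
  let B (i j : ι) : ℝ := RCLike.re (M i j)
  have htrace : ∑ i, B i i = 0 := by simpa [trace] using congrArg RCLike.re hM
  have hform (t : Finset ι) : reForm M (WithLp.toLp 2 fun i => (signVec t i : 𝕜)) =
      chaos Finset.univ B (signVec t) := by
    rw [reForm_eq_sum, chaos, htrace, sub_zero]
    refine Finset.sum_congr rfl fun i _ => Finset.sum_congr rfl fun j _ => ?_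
    change RCLike.re (starRingEnd 𝕜 (signVec t i : 𝕜) * M i j * (signVec t j : 𝕜)) = _
    rw [RCLike.conj_ofReal, RCLike.re_mul_ofReal, RCLike.re_ofReal_mul, mul_comm (signVec t i)]
  have hB : ∑ i, ∑ j, B i j ^ 2 ≤ ‖M‖ ^ 2 := by
    rw [frobenius_norm_sq]
    exact Finset.sum_le_sum fun i _ => Finset.sum_le_sum fun j _ =>
      sq_le_sq' (neg_le_of_abs_le (RCLike.abs_re_le_norm _)) (RCLike.re_le_norm _)
  calc _ = ∑ t ∈ Finset.univ.powerset, chaos Finset.univ B (signVec t) ^ 4 := by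
        simp only [hform, Finset.powerset_univ]
    _ ≤ 2 ^ Fintype.card ι * (108 * (∑ i, ∑ j, B i j ^ 2) ^ 2) :=
        sum_powerset_chaos_pow_four_le _ _
    _ ≤ 2 ^ Fintype.card ι * (108 * (‖M‖ ^ 2) ^ 2) := by gcongr
    _ = _ := by ring

theorem continuous_conj (C : Matrix ι ι 𝕜) : Continuous fun U : unitaryGroup ι 𝕜 => Ad U C := by
  simp only [Unitary.conjStarAlgAut_apply]
  fun_prop

theorem integral_conj_mul_left (V : unitaryGroup ι 𝕜) (C : Matrix ι ι 𝕜) (f : Matrix ι ι 𝕜 → ℝ) :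
    ∫ U, f (Ad V (Ad U C)) ∂haarUnitary 𝕜 ι = ∫ U, f (Ad U C) ∂haarUnitary 𝕜 ι := by
  simpa only [map_mul, StarAlgEquiv.mul_apply] using
    integral_mul_left_eq_self (fun U => f (Ad U C)) V

theorem exists_norm_entry_pow_four_le (i j : ι) :
    ∃ x : Fin 4 → EuclideanSpace 𝕜 ι, (∀ k, ‖x k‖ ≤ 2) ∧
      ∀ M : Matrix ι ι 𝕜, M.IsHermitian → ‖M i j‖ ^ 4 ≤ 4⁻¹ * ∑ k, reForm M (x k) ^ 4 := by
  let e (k : ι) : EuclideanSpace 𝕜 ι := EuclideanSpace.single k 1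
  have he (k : ι) : ‖e k‖ = 1 := by simp [e]
  have hI : ‖(RCLike.I : 𝕜)‖ ≤ 1 := by
    rw [RCLike.norm_I]; split_ifs <;> norm_num
  have hIe : ‖(RCLike.I : 𝕜) • e i‖ ≤ 1 := by rw [norm_smul, he, mul_one]; exact hI
  refine ⟨![e j + e i, e j - e i, e j + (RCLike.I : 𝕜) • e i, e j - (RCLike.I : 𝕜) • e i],
    fun k => ?_, fun M hM => ?_⟩
  · fin_cases k
    · exact (norm_add_le _ _).trans (by rw [he, he]; norm_num)
    · exact (norm_sub_le _ _).trans (by rw [he, he]; norm_num)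
    · exact (norm_add_le _ _).trans (by rw [he]; linarith)
    · exact (norm_sub_le _ _).trans (by rw [he]; linarith)
  have hsymm : (toEuclideanLin M).IsSymmetric := isSymmetric_toEuclideanLin_iff.2 hM
  have hq (z : EuclideanSpace 𝕜 ι) : ‖⟪toEuclideanLin M z, z⟫_𝕜‖ = |reForm M z| := by
    rw [← hsymm.coe_re_inner_apply_self, RCLike.norm_ofReal, hsymm]
    rfl
  have hentry : ‖M i j‖ = ‖⟪toEuclideanLin M (e j), e i⟫_𝕜‖ := by
    simp [e, EuclideanSpace.inner_single_right, toLpLin_apply]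
  have hpolar : ‖M i j‖ ≤ (|reForm M (e j + e i)| + |reForm M (e j - e i)| +
      |reForm M (e j + (RCLike.I : 𝕜) • e i)| + |reForm M (e j - (RCLike.I : 𝕜) • e i)|) / 4 := by
    rw [hentry, hsymm.inner_map_polarization, norm_div, RCLike.norm_ofNat]
    gcongr
    refine (norm_add_le _ _).trans (add_le_add ((norm_sub_le _ _).trans (add_le_add
      ((norm_sub_le _ _).trans (add_le_add (hq _).le (hq _).le)) ?_)) ?_) <;>
    · rw [norm_mul, hq]
      exact mul_le_of_le_one_left (abs_nonneg _) hI
  have hmean := pow_sum_div_card_le_sum_pow (s := Finset.univ) (f := fun k : Fin 4 => |reForm M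
    (![e j + e i, e j - e i, e j + (RCLike.I : 𝕜) • e i, e j - (RCLike.I : 𝕜) • e i] k)|)
    (fun _ _ => abs_nonneg _) 3
  refine (pow_le_pow_left₀ (norm_nonneg _) hpolar 4).trans ?_
  simp only [Fin.sum_univ_four, Finset.card_univ, Fintype.card_fin, Matrix.cons_val,
    Even.pow_abs (by decide : Even 4)] at hmean ⊢
  linear_combination 4⁻¹ * hmean

variable [Nonempty ι] {C : Matrix ι ι 𝕜}

theorem integral_reForm_pow_four_le (hC : C.trace = 0) (x : EuclideanSpace 𝕜 ι) :
    ∫ U, reForm (Ad U C) x ^ 4 ∂haarUnitary 𝕜 ι ≤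
      108 * ‖C‖ ^ 4 * ‖x‖ ^ 8 / Fintype.card ι ^ 4 := by
  have hcard : (0 : ℝ) < Fintype.card ι := by exact_mod_cast Fintype.card_pos
  set c : ℝ := ‖x‖ / √(Fintype.card ι)
  let y (t : Finset ι) : EuclideanSpace 𝕜 ι := WithLp.toLp 2 fun i => (signVec t i : 𝕜)
  have hy (t : Finset ι) : ‖x‖ = ‖(c : 𝕜) • y t‖ := by
    have hyt : ‖y t‖ = √(Fintype.card ι) := by
      simp [y, EuclideanSpace.norm_eq, signVec, apply_ite]
    rw [norm_smul, hyt, RCLike.norm_ofReal, abs_of_nonneg (by positivity), div_mul_cancel₀]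
    positivity
  have hrot (t : Finset ι) : ∫ U, reForm (Ad U C) x ^ 4 ∂haarUnitary 𝕜 ι =
      ∫ U, c ^ 8 * reForm (Ad U C) (y t) ^ 4 ∂haarUnitary 𝕜 ι := by
    obtain ⟨V, hV⟩ := exists_unitary_apply_eq (hy t)
    rw [← integral_conj_mul_left (star V) C fun M => reForm M x ^ 4]
    simp only [reForm_conj, hV, reForm_smul]
    ring_nf
  have hint (t : Finset ι) :
      Integrable (fun U => c ^ 8 * reForm (Ad U C) (y t) ^ 4) (haarUnitary 𝕜 ι) :=
    integrable_haarUnitary (((continuous_reForm _).comp (continuous_conj C)).pow 4 |>.const_mul _)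
  have hsum : 2 ^ Fintype.card ι * ∫ U, reForm (Ad U C) x ^ 4 ∂haarUnitary 𝕜 ι ≤
      2 ^ Fintype.card ι * (108 * ‖C‖ ^ 4 * c ^ 8) :=
    calc _ = ∫ U, ∑ t, c ^ 8 * reForm (Ad U C) (y t) ^ 4 ∂haarUnitary 𝕜 ι := by
          rw [integral_finsetSum _ fun t _ => hint t, ← Finset.sum_congr rfl fun t _ => hrot t]
          simp
      _ ≤ ∫ _, c ^ 8 * (2 ^ Fintype.card ι * (108 * ‖C‖ ^ 4)) ∂haarUnitary 𝕜 ι := by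
          refine integral_mono (integrable_finsetSum _ fun t _ => hint t)
            (integrable_const _) fun U => ?_
          rw [← Finset.mul_sum, ← frobenius_norm_conj U C]
          gcongr
          exact sum_reForm_signVec_pow_four_le (by rw [trace_conj, hC])
      _ = _ := by simp; ring
  refine (le_of_mul_le_mul_left hsum (by positivity)).trans_eq ?_
  rw [div_pow, show √(Fintype.card ι : ℝ) ^ 8 = (√(Fintype.card ι : ℝ) ^ 2) ^ 4 by ring,
    Real.sq_sqrt hcard.le]
  ring

theorem integral_norm_entry_pow_four_le (hC : C.IsHermitian) (htr : C.trace = 0) (i j : ι) :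
    ∫ U, ‖Ad U C i j‖ ^ 4 ∂haarUnitary 𝕜 ι ≤ 27648 * ‖C‖ ^ 4 / Fintype.card ι ^ 4 := by
  obtain ⟨x, hx, hle⟩ := exists_norm_entry_pow_four_le (𝕜 := 𝕜) i j
  have : (0 : ℝ) < Fintype.card ι := by exact_mod_cast Fintype.card_pos
  have hint (k : Fin 4) : Integrable (fun U => reForm (Ad U C) (x k) ^ 4) (haarUnitary 𝕜 ι) :=
    integrable_haarUnitary (((continuous_reForm _).comp (continuous_conj C)).pow 4)
  calc _ ≤ ∫ U, 4⁻¹ * ∑ k, reForm (Ad U C) (x k) ^ 4 ∂haarUnitary 𝕜 ι :=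
        integral_mono (integrable_haarUnitary
            (((continuous_conj C).matrix_elem i j).norm.pow 4))
          ((integrable_finsetSum _ fun k _ => hint k).const_mul _)
          fun U => hle _ (IsSelfAdjoint.map hC (Ad U))
    _ = 4⁻¹ * ∑ k, ∫ U, reForm (Ad U C) (x k) ^ 4 ∂haarUnitary 𝕜 ι := by
        rw [integral_const_mul, integral_finsetSum _ fun k _ => hint k]
    _ ≤ 4⁻¹ * ∑ _k : Fin 4, 108 * ‖C‖ ^ 4 * 2 ^ 8 / Fintype.card ι ^ 4 := by
        gcongr with k
        refine (integral_reForm_pow_four_le htr _).trans ?_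
        gcongr
        exact hx k
    _ = _ := by simp; ring

theorem integral_norm_diagonal_sandwich_le (hC : C.IsHermitian) (htr : C.trace = 0) (d : ι → 𝕜) :
    ∫ U, ‖diagonal d * Ad U C * diagonal d‖ ^ 4 ∂haarUnitary 𝕜 ι ≤
      27648 * ‖C‖ ^ 4 / Fintype.card ι ^ 4 * ‖diagonal d‖ ^ 8 := by
  let w (q : ι × ι) : ℝ := ‖d q.1‖ ^ 2 * ‖d q.2‖ ^ 2
  have hw : ∑ q, w q = ‖diagonal d‖ ^ 4 := by
    have hd : ‖diagonal d‖ ^ 2 = ∑ i, ‖d i‖ ^ 2 := by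
      rw [frobenius_norm_diagonal, EuclideanSpace.norm_sq_eq]
    rw [show ‖diagonal d‖ ^ 4 = ‖diagonal d‖ ^ 2 * ‖diagonal d‖ ^ 2 by ring, hd, Finset.sum_mul_sum,
      Fintype.sum_prod_type]
  have hpoint (M : Matrix ι ι 𝕜) : ‖diagonal d * M * diagonal d‖ ^ 4 ≤
      ‖diagonal d‖ ^ 4 * ∑ q, w q * ‖M q.1 q.2‖ ^ 4 := by
    have hsq : ‖diagonal d * M * diagonal d‖ ^ 2 = ∑ q, w q * ‖M q.1 q.2‖ ^ 2 := by
      rw [frobenius_norm_sq, Fintype.sum_prod_type]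
      refine Finset.sum_congr rfl fun i _ => Finset.sum_congr rfl fun j _ => ?_
      simp only [mul_diagonal, diagonal_mul, norm_mul, w]
      ring
    calc _ = (∑ q, w q * ‖M q.1 q.2‖ ^ 2) ^ 2 := by rw [← hsq]; ring
      _ ≤ (∑ q, w q) * ∑ q, w q * ‖M q.1 q.2‖ ^ 4 :=
        Finset.sum_sq_le_sum_mul_sum_of_sq_le_mul _ (fun q _ => by positivity)
          (fun q _ => by positivity) fun q _ => le_of_eq (by ring)
      _ = _ := by rw [hw]
  have hint (q : ι × ι) : Integrable (fun U => w q * ‖Ad U C q.1 q.2‖ ^ 4) (haarUnitary 𝕜 ι) :=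
    integrable_haarUnitary ((((continuous_conj C).matrix_elem _ _).norm.pow 4).const_mul _)
  calc _ ≤ ∫ U, ‖diagonal d‖ ^ 4 * ∑ q, w q * ‖Ad U C q.1 q.2‖ ^ 4 ∂haarUnitary 𝕜 ι :=
        integral_mono (integrable_haarUnitary
            (((continuous_const.mul (continuous_conj C)).mul continuous_const).norm.pow 4))
          ((integrable_finsetSum _ fun q _ => hint q).const_mul _) fun U => hpoint _
    _ = ‖diagonal d‖ ^ 4 * ∑ q, w q * ∫ U, ‖Ad U C q.1 q.2‖ ^ 4 ∂haarUnitary 𝕜 ι := by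
        rw [integral_const_mul, integral_finsetSum _ fun q _ => hint q]
        simp only [integral_const_mul]
    _ ≤ ‖diagonal d‖ ^ 4 * ∑ q, w q * (27648 * ‖C‖ ^ 4 / Fintype.card ι ^ 4) := by
        gcongr with q
        exact integral_norm_entry_pow_four_le hC htr _ _
    _ = _ := by rw [← Finset.sum_mul, hw]; ring

theorem integral_norm_sandwich_le {P : Matrix ι ι 𝕜} (hC : C.IsHermitian) (htr : C.trace = 0)
    (hP : P.IsHermitian) :
    ∫ U, ‖P * Ad U C * P‖ ^ 4 ∂haarUnitary 𝕜 ι ≤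
      27648 * ‖C‖ ^ 4 / Fintype.card ι ^ 4 * ‖P‖ ^ 8 := by
  obtain ⟨W, d, rfl⟩ : ∃ (W : unitaryGroup ι 𝕜) (d : ι → 𝕜), P = Ad W (diagonal d) :=
    ⟨_, _, hP.spectral_theorem⟩
  have hrot (U : unitaryGroup ι 𝕜) : ‖Ad W (diagonal d) * Ad U C * Ad W (diagonal d)‖ =
      ‖diagonal d * Ad (star W) (Ad U C) * diagonal d‖ := by
    have hcancel : Ad W (Ad (star W) (Ad U C)) = Ad U C := by
      rw [← StarAlgEquiv.mul_apply, ← map_mul, Unitary.mul_star_self, map_one,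
        StarAlgEquiv.one_apply]
    rw [← frobenius_norm_conj W (_ * Ad (star W) _ * _), map_mul, map_mul, hcancel]
  simp only [hrot]
  rw [integral_conj_mul_left (star W) C fun M => ‖diagonal d * M * diagonal d‖ ^ 4,
    frobenius_norm_conj]
  exact integral_norm_diagonal_sandwich_le hC htr d

end Haar

section Compression

variable {𝕜 ι : Type*} [RCLike 𝕜] [Fintype ι] [DecidableEq ι]

local notation "Ad" => Unitary.conjStarAlgAut 𝕜 (Matrix ι ι 𝕜)

/-- The size of the compression by `p` of the centered matrix `x`. The denominator makes its
expectation finite without any integrability assumption on `x`. -/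
def compression (x p : Matrix ι ι 𝕜) : ℝ :=
  ‖p * centered x * p‖ ^ 4 / (1 + (‖x‖ ^ 2 / Fintype.card ι) ^ 2)

theorem compression_nonneg (x p : Matrix ι ι 𝕜) : 0 ≤ compression x p := by
  unfold compression; positivity

theorem continuous_compression {T : Type*} [TopologicalSpace T] {x p : T → Matrix ι ι 𝕜}
    (hx : Continuous x) (hp : Continuous p) : Continuous fun t => compression (x t) (p t) := by
  have hnum := ((hp.mul (continuous_centered.comp hx)).mul hp).norm.pow 4
  exact hnum.div (by fun_prop) fun t => by positivity

theorem measurable_compression {T : Type*} [MeasurableSpace T] {x p : T → Matrix ι ι 𝕜}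
    (hx : Measurable x) (hp : Measurable p) : Measurable fun t => compression (x t) (p t) :=
  (continuous_compression continuous_fst continuous_snd).measurable2 (c := compression) hx hp

theorem compression_conj (U : unitaryGroup ι 𝕜) (x p : Matrix ι ι 𝕜) :
    compression (Ad U x) (Ad U p) = compression x p := by
  rw [compression, compression, centered_conj, ← map_mul, ← map_mul, frobenius_norm_conj,
    frobenius_norm_conj]

theorem continuous_conj_prod :
    Continuous fun q : unitaryGroup ι 𝕜 × Matrix ι ι 𝕜 => Ad q.1 q.2 := by
  simp only [Unitary.conjStarAlgAut_apply]
  fun_prop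

theorem integral_compression_le {x p : Matrix ι ι 𝕜} (hx : x.IsHermitian) (hp : p.IsHermitian) :
    ∫ U, compression (Ad U x) p ∂haarUnitary 𝕜 ι ≤
      27648 * ‖p‖ ^ 8 / (Fintype.card ι : ℝ) ^ 2 := by
  rcases isEmpty_or_nonempty ι with _ | _
  · simp [compression, Subsingleton.elim p 0]
  have : (0 : ℝ) < Fintype.card ι := by exact_mod_cast Fintype.card_pos
  simp only [compression, centered_conj, frobenius_norm_conj]
  rw [integral_div, div_le_iff₀ (by positivity)]
  calc _ ≤ 27648 * ‖centered x‖ ^ 4 / Fintype.card ι ^ 4 * ‖p‖ ^ 8 :=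
        integral_norm_sandwich_le (isHermitian_centered hx) (trace_centered x) hp
    _ ≤ 27648 * ‖x‖ ^ 4 / Fintype.card ι ^ 4 * ‖p‖ ^ 8 := by
        gcongr
        exact frobenius_norm_centered_le x
    _ = 27648 * ‖p‖ ^ 8 / (Fintype.card ι : ℝ) ^ 2 * (‖x‖ ^ 2 / Fintype.card ι) ^ 2 := by
        field_simp
    _ ≤ _ := by
        gcongr
        exact le_add_of_nonneg_left zero_le_one

end Compression

section Randomization

variable {𝕜 : Type*} [RCLike 𝕜] {n : ℕ} {Ω : Type*} [MeasurableSpace Ω] {Pr : Measure Ω}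
  {X P : Ω → Matrix (Fin n) (Fin n) 𝕜}

local notation "Ad" => Unitary.conjStarAlgAut 𝕜 (Matrix (Fin n) (Fin n) 𝕜)

theorem ConjInvariant.map_conj (h : ConjInvariant Pr X) (U : unitaryGroup (Fin n) 𝕜) :
    Pr.map (fun ω => Ad U (X ω)) = Pr.map X :=
  h U U.2

theorem measurable_conj (U : unitaryGroup (Fin n) 𝕜) : Measurable (Ad U) :=
  (continuous_conj_prod.comp (Continuous.prodMk_right U)).measurable

theorem ConjInvariant.comp (h : ConjInvariant Pr X) (hX : Measurable X)
    {f : Matrix (Fin n) (Fin n) 𝕜 → Matrix (Fin n) (Fin n) 𝕜} (hf : Measurable f)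
    (hfU : ∀ U A, f (Ad U A) = Ad U (f A)) : ConjInvariant Pr fun ω => f (X ω) := fun U hU => by
  calc _ = Pr.map fun ω => f (Ad ⟨U, hU⟩ (X ω)) := by simp only [hfU]; rfl
    _ = (Pr.map fun ω => Ad ⟨U, hU⟩ (X ω)).map f :=
      (Measure.map_map hf ((measurable_conj _).comp hX)).symm
    _ = Pr.map fun ω => f (X ω) := by rw [h.map_conj, Measure.map_map hf hX]; rfl

variable [IsProbabilityMeasure Pr]

theorem lintegral_conj_fst (hX : Measurable X) (hP : Measurable P) (hindep : IndepFun X P Pr)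
    (hinv : ConjInvariant Pr X ∨ ConjInvariant Pr P)
    {F : Matrix (Fin n) (Fin n) 𝕜 → Matrix (Fin n) (Fin n) 𝕜 → ENNReal}
    (hF : Measurable (Function.uncurry F)) (hFU : ∀ U x p, F (Ad U x) (Ad U p) = F x p)
    (U : unitaryGroup (Fin n) 𝕜) :
    ∫⁻ ω, F (Ad U (X ω)) (P ω) ∂Pr = ∫⁻ ω, F (X ω) (P ω) ∂Pr := by
  have hlaw {Y Z : Ω → Matrix (Fin n) (Fin n) 𝕜} (hY : Measurable Y) (hZ : Measurable Z)
      (hYZ : IndepFun Y Z Pr) :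
      ∫⁻ ω, F (Y ω) (Z ω) ∂Pr = ∫⁻ q, F q.1 q.2 ∂((Pr.map Y).prod (Pr.map Z)) := by
    rw [← (indepFun_iff_map_prod_eq_prod_map_map hY.aemeasurable hZ.aemeasurable).1 hYZ]
    exact (lintegral_map hF (hY.prodMk hZ)).symm
  rw [hlaw hX hP hindep]
  rcases hinv with h | h
  · rw [← h.map_conj U]
    exact hlaw ((measurable_conj U).comp hX) hP (hindep.comp (measurable_conj U) measurable_id)
  · have hmove (ω : Ω) : F (Ad U (X ω)) (P ω) = F (X ω) (Ad (star U) (P ω)) := by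
      rw [← hFU (star U), ← StarAlgEquiv.mul_apply, ← map_mul, Unitary.star_mul_self, map_one,
        StarAlgEquiv.one_apply]
    simp only [hmove]
    rw [← h.map_conj (star U)]
    exact hlaw hX ((measurable_conj _).comp hP) (hindep.comp measurable_id (measurable_conj _))

theorem lintegral_eq_lintegral_haarUnitary (hX : Measurable X) (hP : Measurable P)
    (hindep : IndepFun X P Pr) (hinv : ConjInvariant Pr X ∨ ConjInvariant Pr P)
    {F : Matrix (Fin n) (Fin n) 𝕜 → Matrix (Fin n) (Fin n) 𝕜 → ENNReal}
    (hF : Measurable (Function.uncurry F)) (hFU : ∀ U x p, F (Ad U x) (Ad U p) = F x p) :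
    ∫⁻ ω, F (X ω) (P ω) ∂Pr =
      ∫⁻ ω, ∫⁻ U, F (Ad U (X ω)) (P ω) ∂haarUnitary 𝕜 (Fin n) ∂Pr := by
  have hjoint : Measurable fun z : unitaryGroup (Fin n) 𝕜 × Ω => F (Ad z.1 (X z.2)) (P z.2) :=
    hF.comp ((continuous_conj_prod.measurable.comp (measurable_fst.prodMk
      (hX.comp measurable_snd))).prodMk (hP.comp measurable_snd))
  rw [← lintegral_lintegral_swap hjoint.aemeasurable]
  simp only [lintegral_conj_fst hX hP hindep hinv hF hFU, lintegral_const, measure_univ, mul_one]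

theorem lintegral_compression_le (hX : Measurable X) (hP : Measurable P)
    (hindep : IndepFun X P Pr) (hinv : ConjInvariant Pr X ∨ ConjInvariant Pr P)
    (hXh : ∀ ω, (X ω).IsHermitian) (hPh : ∀ ω, (P ω).IsHermitian) {S : ℝ}
    (hS : ∀ᵐ ω ∂Pr, ‖P ω‖ ≤ S) :
    ∫⁻ ω, ENNReal.ofReal (compression (X ω) (P ω)) ∂Pr ≤
      ENNReal.ofReal (27648 * S ^ 8 / (n : ℝ) ^ 2) := by
  rw [lintegral_eq_lintegral_haarUnitary hX hP hindep hinv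
    (F := fun x p => ENNReal.ofReal (compression x p))
    (measurable_compression measurable_fst measurable_snd).ennreal_ofReal
    fun U x p => by rw [compression_conj]]
  have hbound : ∀ᵐ ω ∂Pr, ∫⁻ U, ENNReal.ofReal (compression (Ad U (X ω)) (P ω))
      ∂haarUnitary 𝕜 (Fin n) ≤ ENNReal.ofReal (27648 * S ^ 8 / (n : ℝ) ^ 2) := by
    filter_upwards [hS] with ω hω
    have hcont : Continuous fun U => compression (Ad U (X ω)) (P ω) :=
      continuous_compression (continuous_conj (X ω)) continuous_const
    rw [← ofReal_integral_eq_lintegral_ofReal (integrable_haarUnitary hcont)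
      (ae_of_all _ fun _ => compression_nonneg _ _)]
    refine ENNReal.ofReal_le_ofReal ((integral_compression_le (hXh ω) (hPh ω)).trans ?_)
    rw [Fintype.card_fin]
    gcongr
  exact (lintegral_mono_ae hbound).trans_eq (by simp)

end Randomization

section BorelCantelli

variable {𝕜 : Type*} [RCLike 𝕜] {Ω : Type*} [MeasurableSpace Ω] {Pr : Measure Ω}

theorem ae_tendsto_zero_of_lintegral_le {f : ℕ → Ω → ℝ} (hf : ∀ n, Measurable (f n))
    (hf0 : ∀ n ω, 0 ≤ f n ω) {c : ℕ → ℝ} (hc : Summable c)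
    (hle : ∀ᶠ n in atTop, ∫⁻ ω, ENNReal.ofReal (f n ω) ∂Pr ≤ ENNReal.ofReal (c n)) :
    ∀ᵐ ω ∂Pr, Tendsto (fun n => f n ω) atTop (𝓝 0) := by
  obtain ⟨r, hr⟩ := eventually_atTop.1 hle
  have hmeas (n : ℕ) : Measurable fun ω => ENNReal.ofReal (f (n + r) ω) := (hf _).ennreal_ofReal
  have hfin : ∫⁻ ω, ∑' n, ENNReal.ofReal (f (n + r) ω) ∂Pr ≠ ⊤ := by
    rw [lintegral_tsum fun n => (hmeas n).aemeasurable]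
    exact ne_top_of_le_ne_top ((summable_nat_add_iff r).2 hc).tsum_ofReal_ne_top
      (ENNReal.tsum_le_tsum fun n => hr _ (Nat.le_add_left _ _))
  filter_upwards [ae_lt_top (Measurable.tsum hmeas) hfin] with ω hω
  have hlim := (ENNReal.tendsto_toReal ENNReal.zero_ne_top).comp
    (ENNReal.tendsto_atTop_zero_of_tsum_ne_top hω.ne)
  refine (tendsto_add_atTop_iff_nat r).1 (hlim.congr fun n => ?_)
  exact ENNReal.toReal_ofReal (hf0 _ _)

theorem ae_tendsto_compression [IsProbabilityMeasure Pr]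
    {X P : (n : ℕ) → Ω → Matrix (Fin n) (Fin n) 𝕜}
    (hX : ∀ n, Measurable (X n)) (hP : ∀ n, Measurable (P n))
    (hXh : ∀ n ω, (X n ω).IsHermitian) (hPh : ∀ n ω, (P n ω).IsHermitian) {r : ℕ}
    (hindep : ∀ n, r ≤ n → IndepFun (X n) (P n) Pr)
    (hinv : ∀ n, r ≤ n → ConjInvariant Pr (X n) ∨ ConjInvariant Pr (P n)) {S : ℝ}
    (hS : ∀ n, r ≤ n → ∀ᵐ ω ∂Pr, ‖P n ω‖ ≤ S) :
    ∀ᵐ ω ∂Pr, Tendsto (fun n => compression (X n ω) (P n ω)) atTop (𝓝 0) := by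
  refine ae_tendsto_zero_of_lintegral_le (f := fun n ω => compression (X n ω) (P n ω))
    (c := fun n => 27648 * S ^ 8 / (n : ℝ) ^ 2)
    (fun n => measurable_compression (hX n) (hP n))
    (fun n ω => compression_nonneg _ _) ?_ ?_
  · simpa only [div_eq_mul_inv, mul_one] using
      (Real.summable_nat_pow_inv.2 one_lt_two).mul_left (27648 * S ^ 8)
  · filter_upwards [eventually_ge_atTop r] with n hn
    exact lintegral_compression_le (hX n) (hP n) (hindep n hn) (hinv n hn) (hXh n) (hPh n) (hS n hn)

end BorelCantelli

section SpectralExpansion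

variable {𝕜 E κ : Type*} [RCLike 𝕜] [NormedAddCommGroup E] [InnerProductSpace 𝕜 E] [Fintype κ]
  {T : E →ₗ[𝕜] E} {θ : κ → ℝ} {v : κ → E}

/-- The spectral expansion `T = ∑ j, θ j • v j ⊗ (v j)*` along an orthonormal family. The family
need not be complete: it is an eigenbasis for a Hermitian matrix, and the `r` eigenvectors with
nonzero eigenvalues for a perturbation of rank `r`. -/
structure HasSpectralExpansion (T : E →ₗ[𝕜] E) (θ : κ → ℝ) (v : κ → E) : Prop where
  orthonormal : Orthonormal 𝕜 v
  apply_eq_sum : ∀ u, T u = ∑ j, ((θ j : 𝕜) * ⟪v j, u⟫_𝕜) • v j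

namespace HasSpectralExpansion

theorem inner_apply (h : HasSpectralExpansion T θ v) (j : κ) (u : E) :
    ⟪v j, T u⟫_𝕜 = θ j * ⟪v j, u⟫_𝕜 := by
  rw [h.apply_eq_sum, h.orthonormal.inner_right_fintype]

theorem apply_vector (h : HasSpectralExpansion T θ v) (j : κ) : T (v j) = (θ j : 𝕜) • v j := by
  classical
  simp [h.apply_eq_sum, orthonormal_iff_ite.1 h.orthonormal, Finset.sum_ite_eq']

theorem re_inner_apply (h : HasSpectralExpansion T θ v) (u : E) :
    RCLike.re ⟪u, T u⟫_𝕜 = ∑ j, θ j * ‖⟪v j, u⟫_𝕜‖ ^ 2 := by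
  rw [h.apply_eq_sum, inner_sum, map_sum]
  refine Finset.sum_congr rfl fun j _ => ?_
  rw [inner_smul_right, mul_assoc, RCLike.re_ofReal_mul, inner_mul_symm_re_eq_norm, norm_mul,
    norm_inner_symm u, sq]

theorem apply_eq_smul_iff (h : HasSpectralExpansion T θ v) {t : ℝ} (ht : t ≠ 0) {u : E} :
    T u = (t : 𝕜) • u ↔ u ∈ Submodule.span 𝕜 (v '' {j | θ j = t}) := by
  have ht' : (t : 𝕜) ≠ 0 := RCLike.ofReal_ne_zero.2 ht
  refine ⟨fun hu => ?_, fun hu => ?_⟩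
  · rw [← inv_smul_smul₀ ht' u, ← hu, h.apply_eq_sum]
    refine Submodule.smul_mem _ _ (Submodule.sum_mem _ fun j _ => ?_)
    by_cases hj : θ j = t
    · exact Submodule.smul_mem _ _ (Submodule.subset_span ⟨j, hj, rfl⟩)
    · have heq : (θ j : 𝕜) * ⟪v j, u⟫_𝕜 = t * ⟪v j, u⟫_𝕜 := by
        rw [← h.inner_apply, hu, inner_smul_right]
      have hzero : ⟪v j, u⟫_𝕜 = 0 :=
        (mul_eq_mul_right_iff.1 heq).resolve_left (RCLike.ofReal_injective.ne hj)
      rw [hzero, mul_zero, zero_smul]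
      exact Submodule.zero_mem _
  · induction hu using Submodule.span_induction with
    | mem _ hw => obtain ⟨j, rfl, rfl⟩ := hw; exact h.apply_vector j
    | zero => simp
    | add _ _ _ _ h₁ h₂ => rw [map_add, h₁, h₂, smul_add]
    | smul c _ _ h₁ => rw [map_smul, h₁, smul_comm]

end HasSpectralExpansion

omit [Fintype κ] in
theorem norm_starProjection_span_sq [FiniteDimensional 𝕜 E] (hv : Orthonormal 𝕜 v) (s : Finset κ)
    (u : E) :
    ‖(Submodule.span 𝕜 (v '' s)).starProjection u‖ ^ 2 = ∑ j ∈ s, ‖⟪v j, u⟫_𝕜‖ ^ 2 := by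
  classical
  rw [← Finset.coe_image, Submodule.starProjection_apply, Submodule.norm_coe,
    ← (OrthonormalBasis.span hv s).sum_sq_norm_inner_right, ← Finset.sum_coe_sort s]
  refine Finset.sum_congr rfl fun j _ => ?_
  rw [Submodule.inner_orthogonalProjectionOnto_eq_of_mem_left, OrthonormalBasis.span_apply]

end SpectralExpansion

section CourantFischer

variable {𝕜 E : Type*} [RCLike 𝕜] [NormedAddCommGroup E] [InnerProductSpace 𝕜 E] {n : ℕ}
  {T : E →ₗ[𝕜] E} {l : Fin n → ℝ} {b : OrthonormalBasis (Fin n) 𝕜 E}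

theorem exists_mem_inner_eq_zero {ι : Type*} (v : ι → E) (W : Submodule 𝕜 E) [FiniteDimensional 𝕜 W]
    (s : Finset ι) (hs : s.card < Module.finrank 𝕜 W) :
    ∃ u ∈ W, u ≠ 0 ∧ ∀ j ∈ s, ⟪v j, u⟫_𝕜 = 0 := by
  let f : W →ₗ[𝕜] (s → 𝕜) := LinearMap.pi fun j => (innerₛₗ 𝕜 (v j)).comp W.subtype
  have hker : LinearMap.ker f ≠ ⊥ := LinearMap.ker_ne_bot_of_finrank_lt (by simpa using hs)
  obtain ⟨u, hu, hu0⟩ := Submodule.exists_mem_ne_zero_of_ne_bot hker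
  exact ⟨u, u.2, by simpa using hu0, fun j hj => congrFun (LinearMap.mem_ker.1 hu) ⟨j, hj⟩⟩

theorem le_eigenvalue_of_le_form (hT : HasSpectralExpansion T l b) (hl : Antitone l) {i : Fin n}
    {W : Submodule 𝕜 E} (hW : (i : ℕ) + 1 ≤ Module.finrank 𝕜 W) {y : ℝ}
    (h : ∀ u ∈ W, y * ‖u‖ ^ 2 ≤ RCLike.re ⟪u, T u⟫_𝕜) : y ≤ l i := by
  have := b.toBasis.finiteDimensional_of_finite
  obtain ⟨u, huW, hu0, hu⟩ := exists_mem_inner_eq_zero b W (Finset.Iio i) (by simpa using hW)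
  refine le_of_mul_le_mul_right ?_ (by positivity : 0 < ‖u‖ ^ 2)
  calc y * ‖u‖ ^ 2 ≤ ∑ j, l j * ‖⟪b j, u⟫_𝕜‖ ^ 2 := (h u huW).trans_eq (hT.re_inner_apply u)
    _ ≤ ∑ j, l i * ‖⟪b j, u⟫_𝕜‖ ^ 2 := Finset.sum_le_sum fun j _ => by
        by_cases hj : j < i
        · simp [hu j (by simpa using hj)]
        · exact mul_le_mul_of_nonneg_right (hl (not_lt.1 hj)) (sq_nonneg _)
    _ = l i * ‖u‖ ^ 2 := by rw [← Finset.mul_sum, b.sum_sq_norm_inner_right]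

theorem eigenvalue_le_of_form_le (hT : HasSpectralExpansion T l b) (hl : Antitone l) {i : Fin n}
    {W : Submodule 𝕜 E} (hW : n ≤ Module.finrank 𝕜 W + i) {y : ℝ}
    (h : ∀ u ∈ W, RCLike.re ⟪u, T u⟫_𝕜 ≤ y * ‖u‖ ^ 2) : l i ≤ y := by
  have := b.toBasis.finiteDimensional_of_finite
  obtain ⟨u, huW, hu0, hu⟩ := exists_mem_inner_eq_zero b W (Finset.Ioi i) (by
    rw [Fin.card_Ioi]; omega)
  refine le_of_mul_le_mul_right ?_ (by positivity : 0 < ‖u‖ ^ 2)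
  calc l i * ‖u‖ ^ 2 = ∑ j, l i * ‖⟪b j, u⟫_𝕜‖ ^ 2 := by
        rw [← Finset.mul_sum, b.sum_sq_norm_inner_right]
    _ ≤ ∑ j, l j * ‖⟪b j, u⟫_𝕜‖ ^ 2 := Finset.sum_le_sum fun j _ => by
        by_cases hj : i < j
        · simp [hu j (by simpa using hj)]
        · exact mul_le_mul_of_nonneg_right (hl (not_lt.1 hj)) (sq_nonneg _)
    _ ≤ y * ‖u‖ ^ 2 := (hT.re_inner_apply u).symm.trans_le (h u huW)

end CourantFischer

section Hermitian

variable {𝕜 : Type*} [RCLike 𝕜] {n : ℕ} {A : Matrix (Fin n) (Fin n) 𝕜}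

theorem hasSpectralExpansion_eigenvectorBasis (hA : A.IsHermitian) :
    HasSpectralExpansion (toEuclideanLin A) hA.eigenvalues hA.eigenvectorBasis := by
  refine ⟨hA.eigenvectorBasis.orthonormal, fun u => ?_⟩
  have hb (i : Fin n) : toEuclideanLin A (hA.eigenvectorBasis i) =
      (hA.eigenvalues i : 𝕜) • hA.eigenvectorBasis i := by
    rw [toLpLin_apply, hA.mulVec_eigenvectorBasis, RCLike.real_smul_eq_coe_smul (K := 𝕜)]
    rfl
  conv_lhs => rw [← hA.eigenvectorBasis.sum_repr' u]
  simp only [map_sum, map_smul, hb, smul_smul, mul_comm]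

/-- The reordering of `Fin n` behind the eigenvalues of a Hermitian matrix, which turns them into
the decreasing enumeration `lam`. -/
def sortEquiv (n : ℕ) : Fin n ≃ Fin n :=
  (finCongr (Fintype.card_fin n).symm).trans (Fintype.equivOfCardEq (Fintype.card_fin _))

theorem lam_succ_eq_eigenvalues (hA : A.IsHermitian) (i : Fin n) :
    lam hA (i + 1) = hA.eigenvalues (sortEquiv n i) := by
  rw [lam, dif_pos ⟨by omega, i.2⟩]
  simp only [IsHermitian.eigenvalues, sortEquiv, Equiv.trans_apply, Equiv.symm_apply_apply]
  rfl

theorem antitone_lam_succ (hA : A.IsHermitian) : Antitone fun i : Fin n => lam hA (i + 1) := by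
  intro i j hij
  have h (i : Fin n) : 1 ≤ (i : ℕ) + 1 ∧ (i : ℕ) + 1 ≤ n := ⟨by omega, i.2⟩
  simp only [lam, dif_pos (h _)]
  exact hA.eigenvalues₀_antitone (by simpa using hij)

theorem hasSpectralExpansion_lam (hA : A.IsHermitian) :
    HasSpectralExpansion (toEuclideanLin A) (fun i : Fin n => lam hA (i + 1))
      (hA.eigenvectorBasis.reindex (sortEquiv n).symm) := by
  refine ⟨OrthonormalBasis.orthonormal _, fun u => ?_⟩
  rw [(hasSpectralExpansion_eigenvectorBasis hA).apply_eq_sum, ← (sortEquiv n).sum_comp]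
  simp only [lam_succ_eq_eigenvalues, OrthonormalBasis.reindex_apply, Equiv.symm_symm]

theorem eigenvalues_mem_Icc_lam (hA : A.IsHermitian) (i : Fin n) :
    hA.eigenvalues i ∈ Set.Icc (lam hA n) (lam hA 1) := by
  obtain ⟨j, rfl⟩ := (sortEquiv n).surjective i
  rw [← lam_succ_eq_eigenvalues]
  have hn : 0 < n := j.pos
  constructor
  · simpa [Nat.sub_add_cancel hn] using
      antitone_lam_succ hA (show j ≤ ⟨n - 1, by omega⟩ from Fin.le_def.2 (Nat.le_sub_one_of_lt j.2))
  · simpa using antitone_lam_succ hA (show (⟨0, hn⟩ : Fin n) ≤ j from Nat.zero_le _)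

theorem integral_empiricalSpectral (hA : A.IsHermitian) (f : ℝ →ᵇ ℝ) :
    ∫ t, f t ∂(empiricalSpectral hA) = (∑ i, f (hA.eigenvalues i)) / n := by
  rw [empiricalSpectral, integral_smul_measure, integral_finsetSum_measure fun i _ =>
    integrable_dirac (by simp)]
  simp only [integral_dirac, ENNReal.toReal_inv, ENNReal.toReal_natCast, smul_eq_mul]
  rw [← (sortEquiv n).sum_comp, div_eq_inv_mul]
  simp only [← lam_succ_eq_eigenvalues]
  rw [Fin.sum_univ_eq_sum_range (fun i => f (lam hA (i + 1))), Finset.range_eq_Ico,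
    Finset.sum_Ico_add' (fun i => f (lam hA i)) 0 n 1]
  rfl

theorem frobenius_norm_sq_eq_sum_eigenvalues_sq (hA : A.IsHermitian) :
    ‖A‖ ^ 2 = ∑ i, hA.eigenvalues i ^ 2 := by
  conv_lhs => rw [hA.spectral_theorem, frobenius_norm_conj, frobenius_norm_diagonal,
    EuclideanSpace.norm_sq_eq]
  simp

theorem norm_inner_toEuclideanLin_le (M : Matrix (Fin n) (Fin n) 𝕜)
    (x y : EuclideanSpace 𝕜 (Fin n)) : ‖⟪x, toEuclideanLin M y⟫_𝕜‖ ≤ ‖M‖ * ‖x‖ * ‖y‖ := by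
  have hM : ‖toEuclideanLin M y‖ ≤ ‖M‖ * ‖y‖ := by
    refine abs_le_of_sq_le_sq' ?_ (by positivity) |>.2
    rw [EuclideanSpace.norm_sq_eq, mul_pow, EuclideanSpace.norm_sq_eq, frobenius_norm_sq,
      Finset.sum_mul]
    refine Finset.sum_le_sum fun i _ => ?_
    calc ‖∑ j, M i j * y j‖ ^ 2 ≤ (∑ j, ‖M i j‖ * ‖y j‖) ^ 2 := by
          gcongr
          exact (norm_sum_le _ _).trans_eq (by simp only [norm_mul])
      _ ≤ _ := Finset.sum_mul_sq_le_sq_mul_sq _ _ _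
  calc _ ≤ ‖x‖ * ‖toEuclideanLin M y‖ := norm_inner_le_norm _ _
    _ ≤ ‖x‖ * (‖M‖ * ‖y‖) := by gcongr
    _ = _ := by ring

end Hermitian

section NonzeroEigenvalues

variable {𝕜 : Type*} [RCLike 𝕜] {n r : ℕ} {P : Matrix (Fin n) (Fin n) 𝕜} {θ : Fin r → ℝ}

theorem card_fiber_eq_count {α γ : Type*} [Fintype α] [DecidableEq γ] (f : α → γ) (c : γ) :
    Nat.card {a // f a = c} = (Finset.univ.val.map f).count c := by
  rw [Multiset.count_map, Nat.card_eq_fintype_card, Fintype.card_subtype, Finset.card_def,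
    Finset.filter_val]
  simp only [eq_comm]

theorem exists_equiv_of_map_univ_eq {α β γ : Type*} [Fintype α] [Fintype β] {f : α → γ} {g : β → γ}
    (h : Finset.univ.val.map f = Finset.univ.val.map g) : ∃ e : α ≃ β, ∀ a, g (e a) = f a := by
  classical
  have hcard (c : γ) : Nat.card {a // f a = c} = Nat.card {b // g b = c} := by
    rw [card_fiber_eq_count, card_fiber_eq_count, h]
  exact ⟨Equiv.ofFiberEquiv fun c => (Finite.card_eq.1 (hcard c)).some, Equiv.ofFiberEquiv_map _⟩

theorem NonzeroEigenvaluesAre.exists_equiv {hP : P.IsHermitian} (h : NonzeroEigenvaluesAre hP θ) :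
    ∃ e : Fin r ≃ {k // hP.eigenvalues k ≠ 0}, ∀ j, hP.eigenvalues (e j) = θ j := by
  refine exists_equiv_of_map_univ_eq (g := fun k : {k // hP.eigenvalues k ≠ 0} =>
    hP.eigenvalues k) (h.symm.trans ?_)
  rw [Multiset.filter_map, ← Finset.filter_val, ← Finset.subtype_map, Finset.subtype_univ,
    Finset.map_val, Multiset.map_map]
  rfl

theorem NonzeroEigenvaluesAre.frobenius_norm_sq {hP : P.IsHermitian}
    (h : NonzeroEigenvaluesAre hP θ) : ‖P‖ ^ 2 = ∑ j, θ j ^ 2 := by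
  obtain ⟨e, he⟩ := h.exists_equiv
  rw [frobenius_norm_sq_eq_sum_eigenvalues_sq hP]
  refine (Fintype.sum_of_injective (fun j => (e j : Fin n)) (Subtype.val_injective.comp e.injective)
    _ _ (fun k hk => ?_) fun j => by rw [he]).symm
  by_contra hne
  exact hk ⟨e.symm ⟨k, ne_zero_pow two_ne_zero hne⟩, by simp⟩

theorem NonzeroEigenvaluesAre.exists_hasSpectralExpansion {hP : P.IsHermitian}
    (h : NonzeroEigenvaluesAre hP θ) :
    ∃ v : Fin r → EuclideanSpace 𝕜 (Fin n), HasSpectralExpansion (toEuclideanLin P) θ v := by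
  obtain ⟨e, he⟩ := h.exists_equiv
  have hinj : Function.Injective fun j => (e j : Fin n) := Subtype.val_injective.comp e.injective
  refine ⟨fun j => hP.eigenvectorBasis (e j), hP.eigenvectorBasis.orthonormal.comp _ hinj,
    fun u => ?_⟩
  rw [(hasSpectralExpansion_eigenvectorBasis hP).apply_eq_sum]
  refine (Fintype.sum_of_injective _ hinj _ _ (fun k hk => ?_) fun j => by rw [he]).symm
  have hzero : hP.eigenvalues k = 0 := by
    by_contra hne
    exact hk ⟨e.symm ⟨k, hne⟩, by simp⟩
  simp [hzero]

theorem eigKer_eq_span {v : Fin r → EuclideanSpace 𝕜 (Fin n)}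
    (h : HasSpectralExpansion (toEuclideanLin P) θ v) {t : ℝ} (ht : t ≠ 0) :
    eigKer P t = Submodule.span 𝕜 (v '' {j | θ j = t}) := by
  ext u
  rw [← h.apply_eq_smul_iff ht, eigKer, LinearMap.mem_ker, map_sub, map_smul, toLpLin_one,
    LinearMap.sub_apply, LinearMap.smul_apply, LinearMap.id_apply, sub_eq_zero, eq_comm]

theorem projNorm_eigKer_sq {v : Fin r → EuclideanSpace 𝕜 (Fin n)}
    (h : HasSpectralExpansion (toEuclideanLin P) θ v) {t : ℝ} (ht : t ≠ 0)
    (u : EuclideanSpace 𝕜 (Fin n)) :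
    projNorm u (eigKer P t) ^ 2 = ∑ j with θ j = t, ‖⟪v j, u⟫_𝕜‖ ^ 2 := by
  rw [projNorm, eigKer_eq_span h ht, ← norm_starProjection_span_sq h.orthonormal]
  simp

theorem projNorm_iSup_eigKer_sq {v : Fin r → EuclideanSpace 𝕜 (Fin n)}
    (h : HasSpectralExpansion (toEuclideanLin P) θ v) (hθ : ∀ i, θ i ≠ 0) (t : ℝ)
    (u : EuclideanSpace 𝕜 (Fin n)) :
    projNorm u (⨆ (i : Fin r) (_ : θ i ≠ t), eigKer P (θ i)) ^ 2 =
      ∑ j with θ j ≠ t, ‖⟪v j, u⟫_𝕜‖ ^ 2 := by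
  have hspan : (⨆ (i : Fin r) (_ : θ i ≠ t), eigKer P (θ i)) =
      Submodule.span 𝕜 (v '' {j | θ j ≠ t}) := by
    simp only [eigKer_eq_span h (hθ _), ← Submodule.span_iUnion, ← Set.image_iUnion]
    congr 2
    ext j
    simp only [ne_eq, Set.mem_iUnion, Set.mem_ofPred_eq, exists_prop]
    exact ⟨fun ⟨_, hi, hij⟩ => hij ▸ hi, fun hj => ⟨j, hj, rfl⟩⟩
  rw [projNorm, hspan, ← norm_starProjection_span_sq h.orthonormal]
  simp

end NonzeroEigenvalues

section CauchyTransform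

theorem ae_mem_Icc_edge {μ : Measure ℝ} (hμ : IsCompact μ.support) :
    ∀ᵐ t ∂μ, t ∈ Set.Icc (edgeInf μ) (edgeSup μ) := by
  filter_upwards [Measure.support_mem_ae (μ := μ)] with t ht
  exact ⟨csInf_le hμ.bddBelow ht, le_csSup hμ.bddAbove ht⟩

theorem exists_pos_le_abs_sub {a b z : ℝ} (hz : z ∉ Set.Icc a b) :
    ∃ δ > 0, ∀ t ∈ Set.Icc a b, δ ≤ |z - t| := by
  rw [Set.mem_Icc, not_and_or, not_le, not_le] at hz
  rcases hz with hz | hz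
  · refine ⟨a - z, sub_pos.2 hz, fun t ht => ?_⟩
    linarith [neg_le_abs (z - t), ht.1]
  · refine ⟨z - b, sub_pos.2 hz, fun t ht => ?_⟩
    linarith [le_abs_self (z - t), ht.2]

/-- The limit `∫ (z - t)⁻ᵏ dμ(t)` of the normalized traces of the `k`-th power of the resolvent. It
is the Cauchy transform for `k = 1`, and minus its derivative for `k = 2`. -/
def resolventMoment (μ : Measure ℝ) (k : ℕ) (z : ℝ) : ℝ := ∫ t, ((z - t)⁻¹) ^ k ∂μ

variable {μ : Measure ℝ} {a b z : ℝ}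

theorem resolventMoment_one : resolventMoment μ 1 z = cauchyG μ z := by
  simp only [resolventMoment, cauchyG, pow_one, one_div]

theorem Ioi_subset_compl_Icc : Set.Ioi b ⊆ (Set.Icc a b)ᶜ := fun _ hz hm =>
  (Set.mem_Ioi.1 hz).not_ge hm.2

theorem Iio_subset_compl_Icc : Set.Iio a ⊆ (Set.Icc a b)ᶜ := fun _ hz hm =>
  (Set.mem_Iio.1 hz).not_ge hm.1

variable [IsProbabilityMeasure μ]

theorem edgeInf_le_edgeSup (hμ : IsCompact μ.support) : edgeInf μ ≤ edgeSup μ := by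
  obtain ⟨t, ht⟩ := (ae_mem_Icc_edge hμ).exists
  exact ht.1.trans ht.2

theorem integral_pos_of_ae_pos {f : ℝ → ℝ} (hf : Integrable f μ) (hpos : ∀ᵐ t ∂μ, 0 < f t) :
    0 < ∫ t, f t ∂μ := by
  have hnonneg : 0 ≤ᵐ[μ] f := hpos.mono fun t ht => ht.le
  refine (integral_nonneg_of_ae hnonneg).lt_of_ne' fun hzero => ?_
  obtain ⟨t, ht, ht'⟩ := (((integral_eq_zero_iff_of_nonneg_ae hnonneg hf).1 hzero).and hpos).exists
  exact ht'.ne' ht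

theorem integrable_inv_sub_pow (h : ∀ᵐ t ∂μ, t ∈ Set.Icc a b) (hz : z ∉ Set.Icc a b) (k : ℕ) :
    Integrable (fun t => ((z - t)⁻¹) ^ k) μ := by
  obtain ⟨δ, hδ, hd⟩ := exists_pos_le_abs_sub hz
  refine Integrable.of_bound (by fun_prop) ((δ⁻¹) ^ k) (h.mono fun t ht => ?_)
  rw [norm_pow, norm_inv, Real.norm_eq_abs]
  gcongr
  exact hd t ht

theorem resolventMoment_two_pos (h : ∀ᵐ t ∂μ, t ∈ Set.Icc a b) (hz : z ∉ Set.Icc a b) :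
    0 < resolventMoment μ 2 z :=
  integral_pos_of_ae_pos (integrable_inv_sub_pow h hz 2) <| h.mono fun _ ht =>
    sq_pos_of_ne_zero (inv_ne_zero (sub_ne_zero.2 fun hzt => hz (hzt ▸ ht)))

theorem hasDerivAt_cauchyG (h : ∀ᵐ t ∂μ, t ∈ Set.Icc a b) (hz : z ∉ Set.Icc a b) :
    HasDerivAt (cauchyG μ) (-resolventMoment μ 2 z) z := by
  obtain ⟨δ, hδ, hd⟩ := exists_pos_le_abs_sub hz
  have hball : ∀ t ∈ Set.Icc a b, ∀ w ∈ Metric.ball z (δ / 2), δ / 2 ≤ |w - t| := by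
    intro t ht w hw
    rw [Metric.mem_ball, Real.dist_eq, abs_sub_comm] at hw
    linarith [hd t ht, abs_sub_le z w t]
  rw [resolventMoment, ← integral_neg]
  refine (hasDerivAt_integral_of_dominated_loc_of_deriv_le (F := fun w t => 1 / (w - t))
    (F' := fun w t => -((w - t)⁻¹) ^ 2) (bound := fun _ => ((δ / 2)⁻¹) ^ 2)
    (Metric.ball_mem_nhds z (half_pos hδ))
    (Eventually.of_forall fun w => Measurable.aestronglyMeasurable (by fun_prop))
    (by simpa using integrable_inv_sub_pow h hz 1)
    (Measurable.aestronglyMeasurable (by fun_prop)) ?_ (integrable_const _) ?_).2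
  · filter_upwards [h] with t ht w hw
    rw [norm_neg, norm_pow, norm_inv, Real.norm_eq_abs]
    gcongr
    exact hball t ht w hw
  · filter_upwards [h] with t ht w hw
    have hne : w - t ≠ 0 := abs_pos.1 ((half_pos hδ).trans_le (hball t ht w hw))
    simpa [one_div, neg_div] using ((hasDerivAt_id w).sub_const t).fun_inv hne

theorem cauchyG_pos (h : ∀ᵐ t ∂μ, t ∈ Set.Icc a b) (hz : b < z) : 0 < cauchyG μ z := by
  refine integral_pos_of_ae_pos
    (by simpa using integrable_inv_sub_pow h (fun hm => hz.not_ge hm.2) 1) (h.mono fun t ht => ?_)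
  exact one_div_pos.2 (by linarith [ht.2])

theorem cauchyG_neg (h : ∀ᵐ t ∂μ, t ∈ Set.Icc a b) (hz : z < a) : cauchyG μ z < 0 := by
  have hint : Integrable (fun t => -(1 / (z - t))) μ := by
    simpa using (integrable_inv_sub_pow h (fun hm => hz.not_ge hm.1) 1).neg
  have hpos := integral_pos_of_ae_pos hint <| h.mono fun t ht =>
    neg_pos.2 (one_div_neg.2 (by linarith [ht.1]))
  rw [integral_neg] at hpos
  exact neg_pos.1 hpos

theorem continuousOn_cauchyG (h : ∀ᵐ t ∂μ, t ∈ Set.Icc a b) :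
    ContinuousOn (cauchyG μ) (Set.Icc a b)ᶜ := fun _ hz =>
  (hasDerivAt_cauchyG h hz).continuousAt.continuousWithinAt

theorem strictAntiOn_cauchyG (h : ∀ᵐ t ∂μ, t ∈ Set.Icc a b) {D : Set ℝ} (hD : Convex ℝ D)
    (hsub : D ⊆ (Set.Icc a b)ᶜ) : StrictAntiOn (cauchyG μ) D := by
  refine strictAntiOn_of_deriv_neg hD ((continuousOn_cauchyG h).mono hsub) fun z hz => ?_
  have hz' := hsub (interior_subset hz)
  rw [(hasDerivAt_cauchyG h hz').deriv]
  exact neg_neg_of_pos (resolventMoment_two_pos h hz')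

theorem strictAntiOn_cauchyG_Ioi (h : ∀ᵐ t ∂μ, t ∈ Set.Icc a b) :
    StrictAntiOn (cauchyG μ) (Set.Ioi b) :=
  strictAntiOn_cauchyG h (convex_Ioi b) Ioi_subset_compl_Icc

theorem strictAntiOn_cauchyG_Iio (h : ∀ᵐ t ∂μ, t ∈ Set.Icc a b) :
    StrictAntiOn (cauchyG μ) (Set.Iio a) :=
  strictAntiOn_cauchyG h (convex_Iio a) Iio_subset_compl_Icc

theorem cauchyG_le (h : ∀ᵐ t ∂μ, t ∈ Set.Icc a b) (hz : b < z) : cauchyG μ z ≤ 1 / (z - b) := by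
  have hint := integrable_inv_sub_pow h (z := z) (fun hm => hz.not_ge hm.2) 1
  refine (integral_mono_ae (by simpa using hint) (integrable_const (1 / (z - b)))
    (h.mono fun t ht => ?_)).trans (by simp)
  exact one_div_le_one_div_of_le (sub_pos.2 hz) (by linarith [ht.2])

theorem le_cauchyG (h : ∀ᵐ t ∂μ, t ∈ Set.Icc a b) (hz : z < a) : 1 / (z - a) ≤ cauchyG μ z := by
  have hint := integrable_inv_sub_pow h (z := z) (fun hm => hz.not_ge hm.1) 1
  refine le_trans (by simp) (integral_mono_ae (integrable_const (1 / (z - a)))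
    (by simpa using hint) (h.mono fun t ht => ?_))
  exact one_div_le_one_div_of_neg_of_le (sub_neg.2 hz) (by linarith [ht.1])

theorem exists_gt_of_lt_cauchyAtSup (hμ : IsCompact μ.support) {y : ℝ}
    (hy : (y : EReal) < cauchyAtSup μ) : ∃ z, edgeSup μ < z ∧ y < cauchyG μ z := by
  have hanti : AntitoneOn (fun z => (cauchyG μ z : EReal)) (Set.Ioi (edgeSup μ)) :=
    fun x hx w hw hxw => EReal.coe_le_coe_iff.2
      ((strictAntiOn_cauchyG_Ioi (ae_mem_Icc_edge hμ)).antitoneOn hx hw hxw)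
  have hlim := tendsto_rightLim_of_tendsto ⟨_, hanti.tendsto_nhdsGT (OrderTop.bddAbove _)⟩
  obtain ⟨z, hyz, hz⟩ := ((hlim.eventually (lt_mem_nhds hy)).and self_mem_nhdsWithin).exists
  exact ⟨z, hz, EReal.coe_lt_coe_iff.1 hyz⟩

theorem exists_lt_of_cauchyAtInf_lt (hμ : IsCompact μ.support) {y : ℝ}
    (hy : cauchyAtInf μ < (y : EReal)) : ∃ z, z < edgeInf μ ∧ cauchyG μ z < y := by
  have hanti : AntitoneOn (fun z => (cauchyG μ z : EReal)) (Set.Iio (edgeInf μ)) :=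
    fun x hx w hw hxw => EReal.coe_le_coe_iff.2
      ((strictAntiOn_cauchyG_Iio (ae_mem_Icc_edge hμ)).antitoneOn hx hw hxw)
  have hlim := tendsto_leftLim_of_tendsto ⟨_, hanti.tendsto_nhdsLT (OrderBot.bddBelow _)⟩
  obtain ⟨z, hyz, hz⟩ := ((hlim.eventually (gt_mem_nhds hy)).and self_mem_nhdsWithin).exists
  exact ⟨z, hz, EReal.coe_lt_coe_iff.1 hyz⟩

theorem exists_gt_cauchyG_eq (hμ : IsCompact μ.support) {θ : ℝ} (hθ : 0 < θ)
    (h : ((1 / θ : ℝ) : EReal) < cauchyAtSup μ) : ∃ ρ > edgeSup μ, cauchyG μ ρ = 1 / θ := by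
  obtain ⟨z, hz, hGz⟩ := exists_gt_of_lt_cauchyAtSup hμ h
  have hw : edgeSup μ < edgeSup μ + θ := lt_add_of_pos_right _ hθ
  have hGw : cauchyG μ (edgeSup μ + θ) ≤ 1 / θ := by
    simpa using cauchyG_le (ae_mem_Icc_edge hμ) hw
  exact isPreconnected_Ioi.intermediate_value hw hz
    ((continuousOn_cauchyG (ae_mem_Icc_edge hμ)).mono Ioi_subset_compl_Icc) ⟨hGw, hGz.le⟩

theorem exists_lt_cauchyG_eq (hμ : IsCompact μ.support) {θ : ℝ} (hθ : θ < 0)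
    (h : cauchyAtInf μ < ((1 / θ : ℝ) : EReal)) : ∃ ρ < edgeInf μ, cauchyG μ ρ = 1 / θ := by
  obtain ⟨z, hz, hGz⟩ := exists_lt_of_cauchyAtInf_lt hμ h
  have hw : edgeInf μ + θ < edgeInf μ := add_lt_of_neg_right _ hθ
  have hGw : 1 / θ ≤ cauchyG μ (edgeInf μ + θ) := by
    simpa using le_cauchyG (ae_mem_Icc_edge hμ) hw
  exact isPreconnected_Iio.intermediate_value hz hw
    ((continuousOn_cauchyG (ae_mem_Icc_edge hμ)).mono Iio_subset_compl_Icc) ⟨hGz.le, hGw⟩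

theorem injOn_cauchyG (h : ∀ᵐ t ∂μ, t ∈ Set.Icc a b) : Set.InjOn (cauchyG μ) (Set.Icc a b)ᶜ := by
  intro z hz w hw hzw
  rw [Set.mem_compl_iff, Set.mem_Icc, not_and_or, not_le, not_le] at hz hw
  rcases hz with hz | hz <;> rcases hw with hw | hw
  · exact (strictAntiOn_cauchyG_Iio h).injOn hz hw hzw
  · linarith [cauchyG_neg h hz, cauchyG_pos h hw]
  · linarith [cauchyG_neg h hw, cauchyG_pos h hz]
  · exact (strictAntiOn_cauchyG_Ioi h).injOn hz hw hzw

theorem exists_unique_cauchyG_eq (hμ : IsCompact μ.support) {θ : ℝ} (hθ : θ ≠ 0)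
    (h : ((1 / θ : ℝ) : EReal) ∈ Set.Ioo (cauchyAtInf μ) (cauchyAtSup μ)) :
    ∃ ρ, ρ ∉ Set.Icc (edgeInf μ) (edgeSup μ) ∧ cauchyG μ ρ = 1 / θ ∧
      ∀ z ∉ Set.Icc (edgeInf μ) (edgeSup μ), cauchyG μ z = 1 / θ → z = ρ := by
  have hexists : ∃ ρ ∉ Set.Icc (edgeInf μ) (edgeSup μ), cauchyG μ ρ = 1 / θ := by
    rcases hθ.lt_or_gt with hneg | hpos
    · obtain ⟨ρ, hρ, hG⟩ := exists_lt_cauchyG_eq hμ hneg h.1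
      exact ⟨ρ, Iio_subset_compl_Icc hρ, hG⟩
    · obtain ⟨ρ, hρ, hG⟩ := exists_gt_cauchyG_eq hμ hpos h.2
      exact ⟨ρ, Ioi_subset_compl_Icc hρ, hG⟩
  obtain ⟨ρ, hρ, hG⟩ := hexists
  exact ⟨ρ, hρ, hG, fun z hz hGz => injOn_cauchyG (ae_mem_Icc_edge hμ) hz hρ (hGz.trans hG.symm)⟩

end CauchyTransform

section Resolvent

variable {𝕜 ι : Type*} [RCLike 𝕜] [Fintype ι] [DecidableEq ι] {A : Matrix ι ι 𝕜} {z : ℝ}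

local notation "Ad" => Unitary.conjStarAlgAut 𝕜 (Matrix ι ι 𝕜)

theorem resolvent_mul_cancel (hz : z ∉ spectrum ℝ A) :
    resolvent A z * (algebraMap ℝ (Matrix ι ι 𝕜) z - A) = 1 :=
  Ring.inverse_mul_cancel _ (spectrum.notMem_iff.1 hz)

theorem mul_resolvent_cancel (hz : z ∉ spectrum ℝ A) :
    (algebraMap ℝ (Matrix ι ι 𝕜) z - A) * resolvent A z = 1 :=
  Ring.mul_inverse_cancel _ (spectrum.notMem_iff.1 hz)

theorem resolvent_eq_of_mul_eq_one {B : Matrix ι ι 𝕜}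
    (h : (algebraMap ℝ (Matrix ι ι 𝕜) z - A) * B = 1) : resolvent A z = B := by
  rw [resolvent, ← nonsing_inv_eq_ringInverse, inv_eq_right_inv h]

theorem isHermitian_resolvent (hA : A.IsHermitian) (z : ℝ) : (resolvent A z).IsHermitian :=
  ((IsSelfAdjoint.algebraMap _ (.all z)).sub hA.isSelfAdjoint).ringInverse.isHermitian

theorem resolvent_conj (U : unitaryGroup ι 𝕜) (A : Matrix ι ι 𝕜) (z : ℝ) :
    resolvent (Ad U A) z = Ad U (resolvent A z) := by
  have hsub : algebraMap ℝ (Matrix ι ι 𝕜) z - Ad U A = Ad U (algebraMap ℝ _ z - A) := by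
    rw [map_sub, IsScalarTower.algebraMap_apply ℝ 𝕜 (Matrix ι ι 𝕜), AlgHomClass.commutes (Ad U)]
  by_cases hz : z ∈ spectrum ℝ A
  · have hz' : z ∈ spectrum ℝ (Ad U A) := by
      rwa [spectrum.mem_iff, hsub, isUnit_map_iff, ← spectrum.mem_iff]
    rw [spectrum.resolvent_zero_of_mem_spectrum hz, spectrum.resolvent_zero_of_mem_spectrum hz',
      map_zero]
  · refine resolvent_eq_of_mul_eq_one ?_
    rw [hsub, ← map_mul, mul_resolvent_cancel hz, map_one]

theorem measurable_resolvent (z : ℝ) : Measurable fun A : Matrix ι ι 𝕜 => resolvent A z := by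
  have hM : Continuous fun A : Matrix ι ι 𝕜 => algebraMap ℝ (Matrix ι ι 𝕜) z - A := by fun_prop
  simp only [resolvent, ← nonsing_inv_eq_ringInverse, inv_def, Ring.inverse_eq_inv']
  exact continuous_smul.measurable2 (c := fun (s : 𝕜) (M : Matrix ι ι 𝕜) => s • M)
    hM.matrix_det.measurable.inv hM.matrix_adjugate.measurable

theorem resolvent_pow_eq_conj_diagonal (hA : A.IsHermitian) (hz : ∀ i, hA.eigenvalues i ≠ z)
    (k : ℕ) : resolvent A z ^ k = Ad hA.eigenvectorUnitary
      (diagonal fun i => ((((z - hA.eigenvalues i)⁻¹) ^ k : ℝ) : 𝕜)) := by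
  have hdiag : resolvent (diagonal (RCLike.ofReal ∘ hA.eigenvalues) : Matrix ι ι 𝕜) z =
      diagonal fun i => (((z - hA.eigenvalues i)⁻¹ : ℝ) : 𝕜) := by
    refine resolvent_eq_of_mul_eq_one ?_
    rw [algebraMap_eq_diagonal, diagonal_sub, diagonal_mul_diagonal, ← diagonal_one]
    congr 1
    ext i
    simp only [Pi.algebraMap_apply, Function.comp_apply, RCLike.algebraMap_eq_ofReal]
    rw [← RCLike.ofReal_sub, ← RCLike.ofReal_mul, mul_inv_cancel₀ (sub_ne_zero.2 (hz i).symm),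
      RCLike.ofReal_one]
  conv_lhs => rw [hA.spectral_theorem]
  rw [resolvent_conj, hdiag, ← map_pow, diagonal_pow]
  congr 2
  ext i
  simp

theorem trace_resolvent_pow (hA : A.IsHermitian) (hz : ∀ i, hA.eigenvalues i ≠ z) (k : ℕ) :
    (resolvent A z ^ k).trace = ((∑ i, ((z - hA.eigenvalues i)⁻¹) ^ k : ℝ) : 𝕜) := by
  rw [resolvent_pow_eq_conj_diagonal hA hz, trace_conj, trace_diagonal, RCLike.ofReal_sum]

theorem norm_resolvent_pow_sq (hA : A.IsHermitian) (hz : ∀ i, hA.eigenvalues i ≠ z) (k : ℕ) :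
    ‖resolvent A z ^ k‖ ^ 2 = ∑ i, ((z - hA.eigenvalues i)⁻¹) ^ (k * 2) := by
  rw [resolvent_pow_eq_conj_diagonal hA hz, frobenius_norm_conj, frobenius_norm_diagonal,
    EuclideanSpace.norm_sq_eq]
  simp only [RCLike.norm_ofReal, sq_abs, pow_mul]

end Resolvent

section SpectralLimit

/-- The hypotheses on a deterministic sequence of Hermitian matrices: the empirical spectral
distribution converges to a compactly supported `μ`, and no eigenvalue escapes from the convex hull
of the support of `μ` in the limit. -/
structure IsSpectralLimit {𝕜 : Type*} [RCLike 𝕜] {X : (n : ℕ) → Matrix (Fin n) (Fin n) 𝕜}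
    (hX : ∀ n, (X n).IsHermitian) (μ : Measure ℝ) : Prop where
  isCompact_support : IsCompact μ.support
  weaklyConverges : WeaklyConverges (fun n => empiricalSpectral (hX n)) μ
  tendsto_max : Tendsto (fun n => lam (hX n) 1) atTop (𝓝 (edgeSup μ))
  tendsto_min : Tendsto (fun n => lam (hX n) n) atTop (𝓝 (edgeInf μ))

theorem exists_notMem_Icc_enlarged {a b z : ℝ} (hz : z ∉ Set.Icc a b) :
    ∃ a' b' : ℝ, a' < a ∧ b < b' ∧ z ∉ Set.Icc a' b' := by
  rw [Set.mem_Icc, not_and_or, not_le, not_le] at hz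
  rcases hz with hz | hz
  · obtain ⟨a', hza, haa⟩ := exists_between hz
    exact ⟨a', b + 1, haa, lt_add_one b, fun h => hza.not_ge h.1⟩
  · obtain ⟨b', hbb, hbz⟩ := exists_between hz
    exact ⟨a - 1, b', sub_one_lt a, hbb, fun h => hbz.not_ge h.2⟩

namespace IsSpectralLimit

variable {𝕜 : Type*} [RCLike 𝕜] {X : (n : ℕ) → Matrix (Fin n) (Fin n) 𝕜}
  {hX : ∀ n, (X n).IsHermitian} {μ : Measure ℝ} {z : ℝ}

theorem eventually_eigenvalues_mem (h : IsSpectralLimit hX μ) {a b : ℝ} (ha : a < edgeInf μ)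
    (hb : edgeSup μ < b) : ∀ᶠ n in atTop, ∀ i, (hX n).eigenvalues i ∈ Set.Icc a b := by
  filter_upwards [h.tendsto_max.eventually_lt_const hb, h.tendsto_min.eventually_const_lt ha]
    with n hmax hmin i
  have hi := eigenvalues_mem_Icc_lam (hX n) i
  exact ⟨hmin.le.trans hi.1, hi.2.trans hmax.le⟩

theorem eventually_eigenvalues_ne (h : IsSpectralLimit hX μ)
    (hz : z ∉ Set.Icc (edgeInf μ) (edgeSup μ)) :
    ∀ᶠ n in atTop, ∀ i, (hX n).eigenvalues i ≠ z := by
  obtain ⟨a, b, ha, hb, hzab⟩ := exists_notMem_Icc_enlarged hz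
  filter_upwards [h.eventually_eigenvalues_mem ha hb] with n hn i hi
  exact hzab (hi ▸ hn i)

theorem eventually_notMem_spectrum (h : IsSpectralLimit hX μ)
    (hz : z ∉ Set.Icc (edgeInf μ) (edgeSup μ)) : ∀ᶠ n in atTop, z ∉ spectrum ℝ (X n) := by
  filter_upwards [h.eventually_eigenvalues_ne hz] with n hn
  rw [(hX n).spectrum_real_eq_range_eigenvalues]
  exact fun ⟨i, hi⟩ => hn i hi

variable [IsProbabilityMeasure μ]

theorem tendsto_average (h : IsSpectralLimit hX μ) {a b : ℝ} (ha : a < edgeInf μ)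
    (hb : edgeSup μ < b) {f : ℝ → ℝ} (hf : ContinuousOn f (Set.Icc a b)) :
    Tendsto (fun n => (∑ i, f ((hX n).eigenvalues i)) / n) atTop (𝓝 (∫ t, f t ∂μ)) := by
  have hab : a ≤ b := by linarith [edgeInf_le_edgeSup h.isCompact_support]
  let F : ℝ →ᵇ ℝ := (BoundedContinuousFunction.mkOfCompact
    ⟨(Set.Icc a b).domRestrict f, hf.domRestrict⟩).compContinuous ⟨Set.projIcc a b hab,
      continuous_projIcc⟩
  have hF : ∀ t ∈ Set.Icc a b, F t = f t := fun t ht =>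
    congrArg f (congrArg Subtype.val (Set.projIcc_of_mem hab ht))
  have hint : ∫ t, F t ∂μ = ∫ t, f t ∂μ := integral_congr_ae <| by
    filter_upwards [ae_mem_Icc_edge h.isCompact_support] with t ht
    exact hF t ⟨ha.le.trans ht.1, ht.2.trans hb.le⟩
  rw [← hint]
  refine (h.weaklyConverges F).congr' ?_
  filter_upwards [h.eventually_eigenvalues_mem ha hb] with n hn
  rw [integral_empiricalSpectral]
  simp only [hF _ (hn _)]

theorem tendsto_average_resolvent (h : IsSpectralLimit hX μ)
    (hz : z ∉ Set.Icc (edgeInf μ) (edgeSup μ)) (k : ℕ) :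
    Tendsto (fun n => (∑ i, ((z - (hX n).eigenvalues i)⁻¹) ^ k) / n) atTop
      (𝓝 (resolventMoment μ k z)) := by
  obtain ⟨a, b, ha, hb, hzab⟩ := exists_notMem_Icc_enlarged hz
  refine h.tendsto_average ha hb (f := fun t => ((z - t)⁻¹) ^ k)
    ((ContinuousOn.inv₀ (by fun_prop) fun t ht hzt => ?_).pow k)
  exact hzab (sub_eq_zero.1 hzt ▸ ht)

theorem tendsto_trace_resolvent_pow (h : IsSpectralLimit hX μ)
    (hz : z ∉ Set.Icc (edgeInf μ) (edgeSup μ)) (k : ℕ) :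
    Tendsto (fun n => (resolvent (X n) z ^ k).trace / (n : 𝕜)) atTop
      (𝓝 (resolventMoment μ k z : 𝕜)) := by
  refine ((RCLike.continuous_ofReal.tendsto _).comp (h.tendsto_average_resolvent hz k)).congr' ?_
  filter_upwards [h.eventually_eigenvalues_ne hz] with n hn
  rw [trace_resolvent_pow (hX n) hn, Function.comp_apply, RCLike.ofReal_div, RCLike.ofReal_natCast]

theorem tendsto_norm_resolvent_pow_sq (h : IsSpectralLimit hX μ)
    (hz : z ∉ Set.Icc (edgeInf μ) (edgeSup μ)) (k : ℕ) :
    Tendsto (fun n => ‖resolvent (X n) z ^ k‖ ^ 2 / n) atTop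
      (𝓝 (resolventMoment μ (k * 2) z)) := by
  refine (h.tendsto_average_resolvent hz (k * 2)).congr' ?_
  filter_upwards [h.eventually_eigenvalues_ne hz] with n hn
  rw [norm_resolvent_pow_sq (hX n) hn]

end IsSpectralLimit

end SpectralLimit

section SpikedPath

/-- A realization of the spiked model in which everything that holds almost surely does hold: the
spectrum of `X n` has limit `μ`, `P n` has the spectral expansion with eigenvalues `θ` and
eigenvectors `v n`, and the powers of the resolvents of `X n` at the points of `Z`, compressed by
`P n`, approach scalars. In the random model `Z` has to be countable. -/
structure IsSpikedPath {𝕜 : Type*} [RCLike 𝕜] {r : ℕ} {X : (n : ℕ) → Matrix (Fin n) (Fin n) 𝕜}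
    (hX : ∀ n, (X n).IsHermitian) (P : (n : ℕ) → Matrix (Fin n) (Fin n) 𝕜) (μ : Measure ℝ)
    (θ : Fin r → ℝ) (v : (n : ℕ) → Fin r → EuclideanSpace 𝕜 (Fin n)) (Z : Set ℝ) : Prop where
  spectralLimit : IsSpectralLimit hX μ
  ne_zero : ∀ i, θ i ≠ 0
  expansion : ∀ n, r ≤ n → HasSpectralExpansion (toEuclideanLin (P n)) θ (v n)
  tendsto_compression : ∀ k, ∀ z ∈ Z,
    Tendsto (fun n => compression (resolvent (X n) z ^ k) (P n)) atTop (𝓝 0)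

theorem HasSpectralExpansion.inner_sandwich {𝕜 : Type*} [RCLike 𝕜] {n : ℕ} {κ : Type*} [Fintype κ]
    {P : Matrix (Fin n) (Fin n) 𝕜} {θ : κ → ℝ} {v : κ → EuclideanSpace 𝕜 (Fin n)}
    (h : HasSpectralExpansion (toEuclideanLin P) θ v) (C : Matrix (Fin n) (Fin n) 𝕜) (i j : κ) :
    ⟪v i, toEuclideanLin (P * C * P) (v j)⟫_𝕜 =
      (θ i * θ j : 𝕜) * ⟪v i, toEuclideanLin C (v j)⟫_𝕜 := by
  rw [toLpLin_mul_same, toLpLin_mul_same, LinearMap.comp_apply, LinearMap.comp_apply,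
    h.inner_apply, h.apply_vector, map_smul, inner_smul_right, mul_assoc]

theorem inner_centered {𝕜 : Type*} [RCLike 𝕜] {n : ℕ} (A : Matrix (Fin n) (Fin n) 𝕜)
    (x y : EuclideanSpace 𝕜 (Fin n)) :
    ⟪x, toEuclideanLin (centered A) y⟫_𝕜 =
      ⟪x, toEuclideanLin A y⟫_𝕜 - A.trace / n * ⟪x, y⟫_𝕜 := by
  rw [centered, map_sub, map_smul, toLpLin_one, LinearMap.sub_apply, LinearMap.smul_apply,
    LinearMap.id_apply, inner_sub_right, inner_smul_right, Fintype.card_fin]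

namespace IsSpikedPath

variable {𝕜 : Type*} [RCLike 𝕜] {r : ℕ} {X : (n : ℕ) → Matrix (Fin n) (Fin n) 𝕜}
  {hX : ∀ n, (X n).IsHermitian} {P : (n : ℕ) → Matrix (Fin n) (Fin n) 𝕜} {μ : Measure ℝ}
  {θ : Fin r → ℝ} {v : (n : ℕ) → Fin r → EuclideanSpace 𝕜 (Fin n)} {Z : Set ℝ} {z : ℝ}

variable [IsProbabilityMeasure μ]

theorem tendsto_norm_sandwich (h : IsSpikedPath hX P μ θ v Z) (hzZ : z ∈ Z)
    (hz : z ∉ Set.Icc (edgeInf μ) (edgeSup μ)) (k : ℕ) :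
    Tendsto (fun n => ‖P n * centered (resolvent (X n) z ^ k) * P n‖) atTop (𝓝 0) := by
  have hden := ((h.spectralLimit.tendsto_norm_resolvent_pow_sq hz k).pow 2).const_add 1
  have hpow := (h.tendsto_compression k z hzZ).mul hden
  rw [zero_mul] at hpow
  have hroot := hpow.sqrt.sqrt
  rw [Real.sqrt_zero, Real.sqrt_zero] at hroot
  refine hroot.congr fun n => ?_
  rw [compression, Fintype.card_fin, div_mul_cancel₀ _ (by positivity),
    show 4 = 2 * 2 from rfl, pow_mul, Real.sqrt_sq (by positivity), Real.sqrt_sq (norm_nonneg _)]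

theorem tendsto_inner_resolvent_pow (h : IsSpikedPath hX P μ θ v Z) (hzZ : z ∈ Z)
    (hz : z ∉ Set.Icc (edgeInf μ) (edgeSup μ)) (k : ℕ) (i j : Fin r) :
    Tendsto (fun n => ⟪v n i, toEuclideanLin (resolvent (X n) z ^ k) (v n j)⟫_𝕜) atTop
      (𝓝 (if i = j then (resolventMoment μ k z : 𝕜) else 0)) := by
  have hθ : (θ i * θ j : 𝕜) ≠ 0 := by simp [h.ne_zero]
  have hsmall : Tendsto (fun n => ⟪v n i, toEuclideanLin
      (P n * centered (resolvent (X n) z ^ k) * P n) (v n j)⟫_𝕜) atTop (𝓝 0) := by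
    refine squeeze_zero_norm' ?_ (h.tendsto_norm_sandwich hzZ hz k)
    filter_upwards [eventually_ge_atTop r] with n hn
    have hv := (h.expansion n hn).orthonormal.1
    exact (norm_inner_toEuclideanLin_le _ (v n i) (v n j)).trans_eq
      (by rw [hv, hv, mul_one, mul_one])
  have hlim := (hsmall.const_mul (θ i * θ j : 𝕜)⁻¹).add
    ((h.spectralLimit.tendsto_trace_resolvent_pow hz k).mul_const (if i = j then (1 : 𝕜) else 0))
  rw [mul_zero, zero_add, mul_ite, mul_one, mul_zero] at hlim
  refine hlim.congr' ?_
  filter_upwards [eventually_ge_atTop r] with n hn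
  have hexp := h.expansion n hn
  rw [hexp.inner_sandwich, inv_mul_cancel_left₀ hθ, inner_centered,
    orthonormal_iff_ite.1 hexp.orthonormal, sub_add_cancel]

end IsSpikedPath

end SpikedPath

section QuadraticForms

variable {𝕜 E κ : Type*} [RCLike 𝕜] [NormedAddCommGroup E] [InnerProductSpace 𝕜 E]

theorem norm_conj_mul_mul_le {a b e : 𝕜} {p q : ℝ} (hp : ‖e‖ ≤ p) (hq : ‖e‖ ≤ q) :
    ‖starRingEnd 𝕜 a * b * e‖ ≤ (p * ‖a‖ ^ 2 + q * ‖b‖ ^ 2) / 2 := by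
  rw [norm_mul, norm_mul, RCLike.norm_conj]
  nlinarith [mul_le_mul_of_nonneg_right hp (sq_nonneg ‖a‖),
    mul_le_mul_of_nonneg_right hq (sq_nonneg ‖b‖),
    mul_nonneg (norm_nonneg e) (sq_nonneg (‖a‖ - ‖b‖))]

theorem re_conj_mul_mul_ite [DecidableEq κ] (c : κ → 𝕜) (q : κ → ℝ) (i j : κ) :
    RCLike.re (starRingEnd 𝕜 (c i) * c j * if i = j then (q i : 𝕜) else 0) =
      if i = j then q i * ‖c i‖ ^ 2 else 0 := by
  split_ifs with hij
  · rw [← hij, RCLike.conj_mul, ← RCLike.ofReal_pow, ← RCLike.ofReal_mul, RCLike.ofReal_re,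
      mul_comm]
  · rw [mul_zero, map_zero]

theorem exists_submodule_inner_eq_zero [FiniteDimensional 𝕜 E] (v : κ → E) (J : Finset κ) :
    ∃ W : Submodule 𝕜 E, Module.finrank 𝕜 E ≤ Module.finrank 𝕜 W + J.card ∧
      ∀ u ∈ W, ∀ j ∈ J, ⟪v j, u⟫_𝕜 = 0 := by
  classical
  let V : Submodule 𝕜 E := Submodule.span 𝕜 (J.image v)
  refine ⟨Vᗮ, ?_, fun u hu j hj => ?_⟩
  · have hV : Module.finrank 𝕜 V ≤ J.card :=
      (finrank_span_finset_le_card _).trans Finset.card_image_le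
    have := V.finrank_add_finrank_orthogonal
    omega
  · exact hu _ (Submodule.subset_span (Finset.mem_image_of_mem v hj))

variable [Fintype κ]

theorem sum_sum_ite_sub_average_eq_zero [DecidableEq κ] (f : κ → ℝ) :
    ∑ i, ∑ j, ((if i = j then f i else 0) - (f i + f j) / 2 / Fintype.card κ) = 0 := by
  rcases isEmpty_or_nonempty κ with _ | _
  · simp
  · have hcard : (Fintype.card κ : ℝ) ≠ 0 := Nat.cast_ne_zero.2 Fintype.card_ne_zero
    simp only [Finset.sum_sub_distrib, Finset.sum_ite_eq, Finset.mem_univ, if_true,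
      ← Finset.sum_div, Finset.sum_add_distrib, Finset.sum_const, Finset.card_univ, nsmul_eq_mul,
      ← Finset.mul_sum]
    field_simp
    ring

theorem eventually_quadratic_form_nonneg [DecidableEq κ] {M : ℕ → κ → κ → 𝕜} {q : κ → ℝ}
    (hM : ∀ i j, Tendsto (fun n => M n i j) atTop (𝓝 (if i = j then (q i : 𝕜) else 0)))
    (hq : ∀ j, 0 < q j) :
    ∀ᶠ n in atTop, ∀ c : κ → 𝕜,
      0 ≤ RCLike.re (∑ i, ∑ j, starRingEnd 𝕜 (c i) * c j * M n i j) := by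
  have hclose : ∀ᶠ n in atTop, ∀ i j,
      ‖M n i j - if i = j then (q i : 𝕜) else 0‖ ≤
        min (q i / Fintype.card κ) (q j / Fintype.card κ) := by
    refine eventually_all.2 fun i => eventually_all.2 fun j => ?_
    have hcard : (0 : ℝ) < Fintype.card κ := Nat.cast_pos.2 (Fintype.card_pos_iff.2 ⟨i⟩)
    exact (tendsto_zero_iff_norm_tendsto_zero.1
      (tendsto_sub_nhds_zero_iff.2 (hM i j))).eventually_le_const
        (lt_min (div_pos (hq i) hcard) (div_pos (hq j) hcard))
  filter_upwards [hclose] with n hn c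
  rw [← sum_sum_ite_sub_average_eq_zero fun i => q i * ‖c i‖ ^ 2, map_sum]
  refine Finset.sum_le_sum fun i _ => ?_
  rw [map_sum]
  refine Finset.sum_le_sum fun j _ => ?_
  obtain ⟨h₁, h₂⟩ := le_min_iff.1 (hn i j)
  have herr := neg_le_of_abs_le ((RCLike.abs_re_le_norm _).trans
    (norm_conj_mul_mul_le (a := c i) (b := c j) h₁ h₂))
  rw [mul_sub, map_sub, re_conj_mul_mul_ite, div_mul_eq_mul_div, div_mul_eq_mul_div, ← add_div,
    div_right_comm] at herr
  linarith

theorem inner_sum_smul_apply (S : E →ₗ[𝕜] E) (x : κ → E) (c : κ → 𝕜) :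
    ⟪∑ i, c i • x i, S (∑ j, c j • x j)⟫_𝕜 =
      ∑ i, ∑ j, starRingEnd 𝕜 (c i) * c j * ⟪x i, S (x j)⟫_𝕜 := by
  simp only [map_sum, map_smul, sum_inner, inner_sum, inner_smul_left, inner_smul_right, mul_assoc,
    Finset.mul_sum, mul_left_comm]
  exact Finset.sum_comm

theorem exists_submodule_form_nonneg {S : E →ₗ[𝕜] E} {x : κ → E} (hx : LinearIndependent 𝕜 x)
    (hS : ∀ c : κ → 𝕜,
      0 ≤ RCLike.re (∑ i, ∑ j, starRingEnd 𝕜 (c i) * c j * ⟪x i, S (x j)⟫_𝕜)) :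
    ∃ W : Submodule 𝕜 E, Module.finrank 𝕜 W = Fintype.card κ ∧
      ∀ u ∈ W, 0 ≤ RCLike.re ⟪u, S u⟫_𝕜 := by
  refine ⟨Submodule.span 𝕜 (Set.range x), finrank_span_eq_card hx, fun u hu => ?_⟩
  obtain ⟨c, rfl⟩ := (Submodule.mem_span_range_iff_exists_fun 𝕜).1 hu
  rw [inner_sum_smul_apply]
  exact hS c

theorem sum_mul_norm_inner_sq_le_form [DecidableEq κ] {D : E →ₗ[𝕜] E}
    (hD : D.IsPositive) {x v : κ → E} (hx : ∀ j, D (x j) = v j) {η : κ → ℝ} (hη : ∀ j, 0 < η j)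
    (hS : ∀ c : κ → 𝕜, 0 ≤ RCLike.re (∑ i, ∑ j, starRingEnd 𝕜 (c i) * c j *
      ((if i = j then ((η i)⁻¹ : ℝ) else 0 : 𝕜) - ⟪x i, v j⟫_𝕜))) (u : E) :
    ∑ j, η j * ‖⟪v j, u⟫_𝕜‖ ^ 2 ≤ RCLike.re ⟪u, D u⟫_𝕜 := by
  set c : κ → 𝕜 := fun j => η j * ⟪v j, u⟫_𝕜 with hc
  set s : ℝ := ∑ j, η j * ‖⟪v j, u⟫_𝕜‖ ^ 2 with hs
  set w : E := ∑ j, c j • x j with hw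
  have hdiag : ∀ j, (η j)⁻¹ * ‖c j‖ ^ 2 = η j * ‖⟪v j, u⟫_𝕜‖ ^ 2 := fun j => by
    rw [hc, norm_mul, RCLike.norm_ofReal, mul_pow, sq_abs]
    field_simp [(hη j).ne']
  have hww : RCLike.re ⟪w, D w⟫_𝕜 ≤ s := by
    have h := hS c
    simp only [mul_sub, Finset.sum_sub_distrib, map_sub, map_sum,
      re_conj_mul_mul_ite c fun i => (η i)⁻¹, Finset.sum_ite_eq, Finset.mem_univ, if_true,
      hdiag] at h
    rw [hw, inner_sum_smul_apply]
    simp only [map_sum, hx]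
    linarith
  have huw : RCLike.re ⟪u, D w⟫_𝕜 = s := by
    simp only [hw, map_sum, map_smul, hx, inner_sum, inner_smul_right, hs, hc]
    refine Finset.sum_congr rfl fun j _ => ?_
    rw [mul_assoc, RCLike.re_ofReal_mul, inner_mul_symm_re_eq_norm, norm_mul, norm_inner_symm u, sq]
  have hwu : RCLike.re ⟪w, D u⟫_𝕜 = s := by
    rw [← hD.isSymmetric, inner_re_symm, huw]
  have hpos : 0 ≤ RCLike.re ⟪u - w, D (u - w)⟫_𝕜 := hD.re_inner_nonneg_right _
  rw [map_sub, inner_sub_left, inner_sub_right, inner_sub_right, map_sub, map_sub, map_sub, huw,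
    hwu] at hpos
  linarith

theorem sum_mul_norm_inner_sq_le_sum_pos [DecidableEq κ] {v : κ → E} (η : κ → ℝ) {J : Finset κ}
    {u : E} (hu : ∀ j ∈ J, ⟪v j, u⟫_𝕜 = 0) :
    ∑ j, η j * ‖⟪v j, u⟫_𝕜‖ ^ 2 ≤
      ∑ j : {j // j ∉ J ∧ 0 < η j}, η j * ‖⟪v j, u⟫_𝕜‖ ^ 2 := by
  rw [← Finset.sum_subtype (Finset.univ.filter fun j => j ∉ J ∧ 0 < η j) (by simp)
    fun j => η j * ‖⟪v j, u⟫_𝕜‖ ^ 2, Finset.sum_filter]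
  refine Finset.sum_le_sum fun j _ => ?_
  split_ifs with hj
  · exact le_rfl
  · by_cases hjJ : j ∈ J
    · simp [hu j hjJ]
    · exact mul_nonpos_of_nonpos_of_nonneg (not_lt.1 fun h => hj ⟨hjJ, h⟩) (sq_nonneg _)

end QuadraticForms

section OutlierForms

section ScaledShift

variable {𝕜 : Type*} [RCLike 𝕜] {n : ℕ} {A : Matrix (Fin n) (Fin n) 𝕜} {z : ℝ}

theorem toEuclideanLin_sub_apply_resolvent (hz : z ∉ spectrum ℝ A) (u : EuclideanSpace 𝕜 (Fin n)) :
    toEuclideanLin (algebraMap ℝ _ z - A) (toEuclideanLin (resolvent A z) u) = u := by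
  rw [← LinearMap.comp_apply, ← toLpLin_mul_same, mul_resolvent_cancel hz, toLpLin_one,
    LinearMap.id_apply]

theorem toEuclideanLin_resolvent_apply_sub (hz : z ∉ spectrum ℝ A) (u : EuclideanSpace 𝕜 (Fin n)) :
    toEuclideanLin (resolvent A z) (toEuclideanLin (algebraMap ℝ _ z - A) u) = u := by
  rw [← LinearMap.comp_apply, ← toLpLin_mul_same, resolvent_mul_cancel hz, toLpLin_one,
    LinearMap.id_apply]

theorem toEuclideanLin_algebraMap_apply (u : EuclideanSpace 𝕜 (Fin n)) :
    toEuclideanLin (algebraMap ℝ (Matrix (Fin n) (Fin n) 𝕜) z) u = (z : 𝕜) • u := by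
  rw [IsScalarTower.algebraMap_apply ℝ 𝕜, Algebra.algebraMap_eq_smul_one, map_smul, toLpLin_one,
    LinearMap.smul_apply, LinearMap.id_apply, RCLike.algebraMap_eq_ofReal]

theorem re_inner_toEuclideanLin_sub (A : Matrix (Fin n) (Fin n) 𝕜) (z : ℝ)
    (u : EuclideanSpace 𝕜 (Fin n)) :
    RCLike.re ⟪u, toEuclideanLin (algebraMap ℝ _ z - A) u⟫_𝕜 =
      z * ‖u‖ ^ 2 - RCLike.re ⟪u, toEuclideanLin A u⟫_𝕜 := by
  rw [map_sub, LinearMap.sub_apply, toEuclideanLin_algebraMap_apply, inner_sub_right,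
    inner_smul_right, map_sub, RCLike.re_ofReal_mul, inner_self_eq_norm_sq]

/-- The operator `g (z - A)`. With `g = G(z)` for a Cauchy transform `G` it is positive when the
spectrum of `A` lies on the appropriate side of `z`, which treats the two sides of the support
alike. -/
def scaledShift (A : Matrix (Fin n) (Fin n) 𝕜) (g z : ℝ) :
    EuclideanSpace 𝕜 (Fin n) →ₗ[𝕜] EuclideanSpace 𝕜 (Fin n) :=
  (g : 𝕜) • toEuclideanLin (algebraMap ℝ _ z - A)

/-- The solution `x` of `g (z - A) x = y`. For `g = G(z)` and `y` among the eigenvectors of the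
perturbation these vectors are asymptotically dual to the eigenvectors themselves. -/
def dualVector (A : Matrix (Fin n) (Fin n) 𝕜) (g z : ℝ) (y : EuclideanSpace 𝕜 (Fin n)) :
    EuclideanSpace 𝕜 (Fin n) :=
  (g : 𝕜)⁻¹ • toEuclideanLin (resolvent A z) y

theorem scaledShift_dualVector {g : ℝ} (hg : g ≠ 0) (hz : z ∉ spectrum ℝ A)
    (y : EuclideanSpace 𝕜 (Fin n)) : scaledShift A g z (dualVector A g z y) = y := by
  rw [scaledShift, dualVector, LinearMap.smul_apply, map_smul,
    toEuclideanLin_sub_apply_resolvent hz, smul_inv_smul₀ (RCLike.ofReal_ne_zero.2 hg)]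

theorem re_inner_smul_sub_scaledShift (A P : Matrix (Fin n) (Fin n) 𝕜) (g z : ℝ)
    (u : EuclideanSpace 𝕜 (Fin n)) :
    RCLike.re ⟪u, ((g : 𝕜) • toEuclideanLin P - scaledShift A g z) u⟫_𝕜 =
        g * (RCLike.re ⟪u, toEuclideanLin (A + P) u⟫_𝕜 - z * ‖u‖ ^ 2) := by
  rw [scaledShift, ← smul_sub, LinearMap.smul_apply, inner_smul_right, RCLike.re_ofReal_mul,
    LinearMap.sub_apply, inner_sub_right, map_sub, re_inner_toEuclideanLin_sub, map_add,
    LinearMap.add_apply, inner_add_right, map_add]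
  ring

theorem isPositive_scaledShift (hA : A.IsHermitian) {g : ℝ}
    (h : ∀ i, 0 ≤ g * (z - hA.eigenvalues i)) :
    (scaledShift A g z).IsPositive := by
  refine ⟨?_, fun u => ?_⟩
  · exact (isSymmetric_toEuclideanLin_iff.2 ((IsSelfAdjoint.algebraMap _ (.all z)).sub
      hA.isSelfAdjoint).isHermitian).smul (RCLike.conj_ofReal g)
  · rw [inner_re_symm, scaledShift, LinearMap.smul_apply, inner_smul_right, RCLike.re_ofReal_mul,
      re_inner_toEuclideanLin_sub, (hasSpectralExpansion_eigenvectorBasis hA).re_inner_apply,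
      ← hA.eigenvectorBasis.sum_sq_norm_inner_right, Finset.mul_sum, ← Finset.sum_sub_distrib,
      Finset.mul_sum]
    refine Finset.sum_nonneg fun i _ => ?_
    rw [← sub_mul, ← mul_assoc]
    exact mul_nonneg (h i) (sq_nonneg _)

end ScaledShift

theorem cauchyG_mul_sub_pos {μ : Measure ℝ} [IsProbabilityMeasure μ] {a b a' b' z t : ℝ}
    (h : ∀ᵐ t ∂μ, t ∈ Set.Icc a b) (ha : a' ≤ a) (hb : b ≤ b') (hz : z ∉ Set.Icc a' b')
    (ht : t ∈ Set.Icc a' b') : 0 < cauchyG μ z * (z - t) := by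
  rw [Set.mem_Icc, not_and_or, not_le, not_le] at hz
  rcases hz with hz | hz
  · exact mul_pos_of_neg_of_neg (cauchyG_neg h (hz.trans_le ha)) (sub_neg.2 (hz.trans_le ht.1))
  · exact mul_pos (cauchyG_pos h (hb.trans_lt hz)) (sub_pos.2 (ht.2.trans_lt hz))

namespace IsSpectralLimit

variable {𝕜 : Type*} [RCLike 𝕜] {X : (n : ℕ) → Matrix (Fin n) (Fin n) 𝕜}
  {hX : ∀ n, (X n).IsHermitian} {μ : Measure ℝ} [IsProbabilityMeasure μ] {z : ℝ}

theorem cauchyG_ne_zero (h : IsSpectralLimit hX μ) (hz : z ∉ Set.Icc (edgeInf μ) (edgeSup μ)) :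
    cauchyG μ z ≠ 0 :=
  left_ne_zero_of_mul <| ne_of_gt <|
    cauchyG_mul_sub_pos (ae_mem_Icc_edge h.isCompact_support) le_rfl le_rfl hz <|
      Set.left_mem_Icc.2 (edgeInf_le_edgeSup h.isCompact_support)

theorem eventually_isPositive (h : IsSpectralLimit hX μ)
    (hz : z ∉ Set.Icc (edgeInf μ) (edgeSup μ)) : ∀ᶠ n in atTop,
      (scaledShift (X n) (cauchyG μ z) z).IsPositive := by
  obtain ⟨a, b, ha, hb, hzab⟩ := exists_notMem_Icc_enlarged hz
  filter_upwards [h.eventually_eigenvalues_mem ha hb] with n hn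
  exact isPositive_scaledShift (hX n) fun i =>
    (cauchyG_mul_sub_pos (ae_mem_Icc_edge h.isCompact_support) ha.le hb.le hzab (hn i)).le

theorem eventually_scaledShift_dualVector (h : IsSpectralLimit hX μ)
    (hz : z ∉ Set.Icc (edgeInf μ) (edgeSup μ)) : ∀ᶠ n in atTop, ∀ y,
      scaledShift (X n) (cauchyG μ z) z (dualVector (X n) (cauchyG μ z) z y) = y := by
  filter_upwards [h.eventually_notMem_spectrum hz] with n hn y
  exact scaledShift_dualVector (h.cauchyG_ne_zero hz) hn y

end IsSpectralLimit

namespace IsSpikedPath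

variable {𝕜 : Type*} [RCLike 𝕜] {r : ℕ} {X : (n : ℕ) → Matrix (Fin n) (Fin n) 𝕜}
  {hX : ∀ n, (X n).IsHermitian} {P : (n : ℕ) → Matrix (Fin n) (Fin n) 𝕜} {μ : Measure ℝ}
  [IsProbabilityMeasure μ] {θ : Fin r → ℝ} {v : (n : ℕ) → Fin r → EuclideanSpace 𝕜 (Fin n)}
  {Z : Set ℝ} {z : ℝ}

theorem tendsto_inner_dualVector (h : IsSpikedPath hX P μ θ v Z) (hzZ : z ∈ Z)
    (hz : z ∉ Set.Icc (edgeInf μ) (edgeSup μ)) (i j : Fin r) :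
    Tendsto (fun n => ⟪v n i, dualVector (X n) (cauchyG μ z) z (v n j)⟫_𝕜) atTop
      (𝓝 (if i = j then 1 else 0)) := by
  have hlim := (h.tendsto_inner_resolvent_pow hzZ hz 1 i j).const_mul (cauchyG μ z : 𝕜)⁻¹
  rw [resolventMoment_one, mul_ite, mul_zero,
    inv_mul_cancel₀ (RCLike.ofReal_ne_zero.2 (h.spectralLimit.cauchyG_ne_zero hz))] at hlim
  simpa only [dualVector, inner_smul_right, pow_one] using hlim

theorem tendsto_inner_dualVector_left (h : IsSpikedPath hX P μ θ v Z) (hzZ : z ∈ Z)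
    (hz : z ∉ Set.Icc (edgeInf μ) (edgeSup μ)) (i j : Fin r) :
    Tendsto (fun n => ⟪dualVector (X n) (cauchyG μ z) z (v n i), v n j⟫_𝕜) atTop
      (𝓝 (if i = j then 1 else 0)) := by
  have hlim := (RCLike.continuous_conj.tendsto _).comp (h.tendsto_inner_dualVector hzZ hz j i)
  rw [apply_ite (starRingEnd 𝕜), map_one, map_zero] at hlim
  simpa only [Function.comp_def, inner_conj_symm, eq_comm (a := j)] using hlim

theorem tendsto_inner_dualVector_sub (h : IsSpikedPath hX P μ θ v Z) (hzZ : z ∈ Z)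
    (hz : z ∉ Set.Icc (edgeInf μ) (edgeSup μ)) (i j : Fin r) :
    Tendsto (fun n => ⟪dualVector (X n) (cauchyG μ z) z (v n i),
      ((cauchyG μ z : 𝕜) • toEuclideanLin (P n) -
        scaledShift (X n) (cauchyG μ z) z) (dualVector (X n) (cauchyG μ z) z (v n j))⟫_𝕜) atTop
      (𝓝 (if i = j then ((cauchyG μ z * θ i - 1 : ℝ) : 𝕜) else 0)) := by
  have hsum := (tendsto_finsetSum Finset.univ fun k _ =>
    ((h.tendsto_inner_dualVector hzZ hz k j).const_mul (θ k : 𝕜)).mul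
      (h.tendsto_inner_dualVector_left hzZ hz i k)).const_mul (cauchyG μ z : 𝕜)
  have hlim := hsum.sub (h.tendsto_inner_dualVector_left hzZ hz i j)
  simp only [mul_ite, mul_one, mul_zero, Finset.sum_ite_eq, Finset.mem_univ, if_true,
    ite_sub_ite, sub_zero, ← RCLike.ofReal_mul] at hlim
  rw [RCLike.ofReal_sub, RCLike.ofReal_one]
  refine hlim.congr' ?_
  filter_upwards [eventually_ge_atTop r, h.spectralLimit.eventually_scaledShift_dualVector hz]
    with n hn hdual
  rw [LinearMap.sub_apply, hdual, LinearMap.smul_apply, (h.expansion n hn).apply_eq_sum,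
    inner_sub_right, inner_smul_right, inner_sum]
  simp only [inner_smul_right]

theorem exists_submodule_le_form (h : IsSpikedPath hX P μ θ v Z) (hzZ : z ∈ Z)
    (hz : z ∉ Set.Icc (edgeInf μ) (edgeSup μ)) {J : Finset (Fin r)}
    (hJ : ∀ j ∈ J, 1 < cauchyG μ z * θ j) : ∀ᶠ n in atTop,
    ∃ W : Submodule 𝕜 (EuclideanSpace 𝕜 (Fin n)), Module.finrank 𝕜 W = J.card ∧
      ∀ u ∈ W, 0 ≤ cauchyG μ z *
        (RCLike.re ⟪u, toEuclideanLin (X n + P n) u⟫_𝕜 - z * ‖u‖ ^ 2) := by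
  have hform := eventually_quadratic_form_nonneg (q := fun j : J => cauchyG μ z * θ j - 1)
    (fun i j => by
      simpa only [Subtype.ext_iff] using h.tendsto_inner_dualVector_sub hzZ hz i j)
    (fun j => sub_pos.2 (hJ j j.2))
  filter_upwards [hform, eventually_ge_atTop r,
    h.spectralLimit.eventually_scaledShift_dualVector hz] with n hn hr hdual
  have hindep : LinearIndependent 𝕜 fun j : J => dualVector (X n) (cauchyG μ z) z (v n j) := by
    refine .of_comp (scaledShift (X n) (cauchyG μ z) z) ?_
    simpa only [Function.comp_def, hdual] using
      (h.expansion n hr).orthonormal.linearIndependent.comp _ Subtype.val_injective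
  obtain ⟨W, hW, hu⟩ := exists_submodule_form_nonneg hindep hn
  exact ⟨W, hW.trans (Fintype.card_coe J), fun u huW =>
    (hu u huW).trans_eq (re_inner_smul_sub_scaledShift _ _ _ _ _)⟩

theorem exists_submodule_form_le (h : IsSpikedPath hX P μ θ v Z) (hzZ : z ∈ Z)
    (hz : z ∉ Set.Icc (edgeInf μ) (edgeSup μ)) {J : Finset (Fin r)}
    (hJ : ∀ j ∉ J, cauchyG μ z * θ j < 1) : ∀ᶠ n in atTop,
    ∃ W : Submodule 𝕜 (EuclideanSpace 𝕜 (Fin n)), n ≤ Module.finrank 𝕜 W + J.card ∧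
      ∀ u ∈ W, cauchyG μ z *
        (RCLike.re ⟪u, toEuclideanLin (X n + P n) u⟫_𝕜 - z * ‖u‖ ^ 2) ≤ 0 := by
  let K := {j : Fin r // j ∉ J ∧ 0 < cauchyG μ z * θ j}
  let η : K → ℝ := fun j => cauchyG μ z * θ j
  have hform := eventually_quadratic_form_nonneg (κ := K) (q := fun j => (η j)⁻¹ - 1)
    (M := fun n i j => (if i = j then ((η i)⁻¹ : ℝ) else 0 : 𝕜) -
      ⟪dualVector (X n) (cauchyG μ z) z (v n i), v n j⟫_𝕜)
    (fun i j => by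
      have hlim := (h.tendsto_inner_dualVector_left hzZ hz i j).const_sub
        (if i = j then ((η i)⁻¹ : ℝ) else 0 : 𝕜)
      convert hlim using 2
      by_cases hij : i = j
      · rw [if_pos hij, if_pos hij, if_pos (congrArg _ hij), RCLike.ofReal_sub, RCLike.ofReal_one]
      · rw [if_neg hij, if_neg hij, if_neg (Subtype.val_injective.ne hij), sub_zero])
    (fun j => sub_pos.2 (one_lt_inv_iff₀.2 ⟨j.2.2, hJ j j.2.1⟩))
  filter_upwards [hform, eventually_ge_atTop r, h.spectralLimit.eventually_isPositive hz,
    h.spectralLimit.eventually_scaledShift_dualVector hz] with n hn hr hpos hdual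
  obtain ⟨W, hW, hu⟩ := exists_submodule_inner_eq_zero (𝕜 := 𝕜) (v n) J
  rw [finrank_euclideanSpace_fin] at hW
  refine ⟨W, hW, fun u huW => ?_⟩
  have hle : ∑ j, cauchyG μ z * θ j * ‖⟪v n j, u⟫_𝕜‖ ^ 2 ≤
      RCLike.re ⟪u, scaledShift (X n) (cauchyG μ z) z u⟫_𝕜 :=
    (sum_mul_norm_inner_sq_le_sum_pos (fun j => cauchyG μ z * θ j) (hu u huW)).trans
      (sum_mul_norm_inner_sq_le_form hpos (fun j => hdual _) (fun j => j.2.2) hn u)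
  rw [← re_inner_smul_sub_scaledShift, LinearMap.sub_apply, inner_sub_right, map_sub, sub_nonpos,
    LinearMap.smul_apply, inner_smul_right, RCLike.re_ofReal_mul, (h.expansion n hr).re_inner_apply,
    Finset.mul_sum]
  simpa only [mul_assoc] using hle

end IsSpikedPath

end OutlierForms

section OutlierLocation

theorem tendsto_of_eventually_le_of_dense {l : ℕ → ℝ} {ρ : ℝ} {U Z : Set ℝ} (hU : U ∈ 𝓝 ρ)
    (hZ : Dense Z) (hlt : ∀ z ∈ Z, z ∈ U → z < ρ → ∀ᶠ n in atTop, z ≤ l n)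
    (hgt : ∀ z ∈ Z, z ∈ U → ρ < z → ∀ᶠ n in atTop, l n ≤ z) : Tendsto l atTop (𝓝 ρ) := by
  obtain ⟨a, b, ⟨ha, hb⟩, hab⟩ := mem_nhds_iff_exists_Ioo_subset.1 hU
  refine tendsto_order.2 ⟨fun y hy => ?_, fun y hy => ?_⟩
  · obtain ⟨z, hzZ, hz, hzρ⟩ := hZ.exists_between (max_lt hy ha)
    rw [max_lt_iff] at hz
    exact (hlt z hzZ (hab ⟨hz.2, hzρ.trans hb⟩) hzρ).mono fun _ hn => hz.1.trans_le hn
  · obtain ⟨z, hzZ, hρz, hz⟩ := hZ.exists_between (lt_min hy hb)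
    rw [lt_min_iff] at hz
    exact (hgt z hzZ (hab ⟨ha.trans hρz, hz.2⟩) hρz).mono fun _ hn => hn.trans_lt hz.1

namespace IsSpikedPath

variable {𝕜 : Type*} [RCLike 𝕜] {r : ℕ} {X : (n : ℕ) → Matrix (Fin n) (Fin n) 𝕜}
  {hX : ∀ n, (X n).IsHermitian} {P : (n : ℕ) → Matrix (Fin n) (Fin n) 𝕜} {μ : Measure ℝ}
  [IsProbabilityMeasure μ] {θ : Fin r → ℝ} {v : (n : ℕ) → Fin r → EuclideanSpace 𝕜 (Fin n)}
  {Z : Set ℝ} {z : ℝ} {i₀ : Fin r}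

theorem eventually_le_lam_of_pos (h : IsSpikedPath hX P μ θ v Z) (hP : ∀ n, (P n).IsHermitian)
    (hθ : Antitone θ) (hi₀ : 0 < θ i₀) (hzZ : z ∈ Z) (hz : edgeSup μ < z)
    (hG : 1 < cauchyG μ z * θ i₀) :
    ∀ᶠ n in atTop, z ≤ lam ((hX n).add (hP n)) (outlierPos n θ i₀) := by
  have hGpos := cauchyG_pos (ae_mem_Icc_edge h.spectralLimit.isCompact_support) hz
  filter_upwards [h.exists_submodule_le_form hzZ (Ioi_subset_compl_Icc hz) (J := Finset.Iic i₀)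
    fun j hj => hG.trans_le (mul_le_mul_of_nonneg_left (hθ (Finset.mem_Iic.1 hj)) hGpos.le),
    eventually_ge_atTop r] with n ⟨W, hW, hu⟩ hn
  rw [outlierPos, if_pos hi₀]
  refine le_eigenvalue_of_le_form (hasSpectralExpansion_lam _) (antitone_lam_succ _)
    (i := ⟨i₀, by omega⟩) (by rw [hW, Fin.card_Iic]) fun u huW => ?_
  exact sub_nonneg.1 (nonneg_of_mul_nonneg_right (hu u huW) hGpos)

theorem eventually_lam_le_of_pos (h : IsSpikedPath hX P μ θ v Z) (hP : ∀ n, (P n).IsHermitian)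
    (hθ : Antitone θ) (hi₀ : 0 < θ i₀) (hzZ : z ∈ Z) (hz : edgeSup μ < z)
    (hG : cauchyG μ z * θ i₀ < 1) :
    ∀ᶠ n in atTop, lam ((hX n).add (hP n)) (outlierPos n θ i₀) ≤ z := by
  have hGpos := cauchyG_pos (ae_mem_Icc_edge h.spectralLimit.isCompact_support) hz
  filter_upwards [h.exists_submodule_form_le hzZ (Ioi_subset_compl_Icc hz) (J := Finset.Iio i₀)
    fun j hj => (mul_le_mul_of_nonneg_left
      (hθ (not_lt.1 (Finset.mem_Iio.not.1 hj))) hGpos.le).trans_lt hG,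
    eventually_ge_atTop r] with n ⟨W, hW, hu⟩ hn
  rw [outlierPos, if_pos hi₀]
  refine eigenvalue_le_of_form_le (hasSpectralExpansion_lam _) (antitone_lam_succ _)
    (i := ⟨i₀, by omega⟩) (by rwa [Fin.card_Iio] at hW) fun u huW => ?_
  exact sub_nonpos.1 (nonpos_of_mul_nonpos_right (hu u huW) hGpos)

theorem eventually_lam_le_of_neg (h : IsSpikedPath hX P μ θ v Z) (hP : ∀ n, (P n).IsHermitian)
    (hθ : Antitone θ) (hi₀ : θ i₀ < 0) (hzZ : z ∈ Z) (hz : z < edgeInf μ)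
    (hG : 1 < cauchyG μ z * θ i₀) :
    ∀ᶠ n in atTop, lam ((hX n).add (hP n)) (outlierPos n θ i₀) ≤ z := by
  have hGneg := cauchyG_neg (ae_mem_Icc_edge h.spectralLimit.isCompact_support) hz
  filter_upwards [h.exists_submodule_le_form hzZ (Iio_subset_compl_Icc hz) (J := Finset.Ici i₀)
    fun j hj => hG.trans_le (mul_le_mul_of_nonpos_left (hθ (Finset.mem_Ici.1 hj)) hGneg.le),
    eventually_ge_atTop r] with n ⟨W, hW, hu⟩ hn
  rw [outlierPos, if_neg hi₀.not_gt]
  refine eigenvalue_le_of_form_le (hasSpectralExpansion_lam _) (antitone_lam_succ _)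
    (i := ⟨n - r + i₀, by omega⟩) (by rw [hW, Fin.card_Ici]; dsimp only; omega) fun u huW => ?_
  exact sub_nonpos.1 (nonpos_of_mul_nonneg_right (hu u huW) hGneg)

theorem eventually_le_lam_of_neg (h : IsSpikedPath hX P μ θ v Z) (hP : ∀ n, (P n).IsHermitian)
    (hθ : Antitone θ) (hi₀ : θ i₀ < 0) (hzZ : z ∈ Z) (hz : z < edgeInf μ)
    (hG : cauchyG μ z * θ i₀ < 1) :
    ∀ᶠ n in atTop, z ≤ lam ((hX n).add (hP n)) (outlierPos n θ i₀) := by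
  have hGneg := cauchyG_neg (ae_mem_Icc_edge h.spectralLimit.isCompact_support) hz
  filter_upwards [h.exists_submodule_form_le hzZ (Iio_subset_compl_Icc hz) (J := Finset.Ioi i₀)
    fun j hj => (mul_le_mul_of_nonpos_left
      (hθ (not_lt.1 (Finset.mem_Ioi.not.1 hj))) hGneg.le).trans_lt hG,
    eventually_ge_atTop r] with n ⟨W, hW, hu⟩ hn
  rw [Fin.card_Ioi] at hW
  rw [outlierPos, if_neg hi₀.not_gt]
  refine le_eigenvalue_of_le_form (hasSpectralExpansion_lam _) (antitone_lam_succ _)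
    (W := W) (i := ⟨n - r + i₀, by omega⟩) (by dsimp only; omega) fun u huW => ?_
  exact sub_nonneg.1 (nonneg_of_mul_nonpos_right (hu u huW) hGneg)

theorem tendsto_lam_outlierPos (h : IsSpikedPath hX P μ θ v Z) (hP : ∀ n, (P n).IsHermitian)
    (hθ : Antitone θ) (hZ : Dense Z) {ρ : ℝ} (hρ : ρ ∉ Set.Icc (edgeInf μ) (edgeSup μ))
    (hG : cauchyG μ ρ = 1 / θ i₀) :
    Tendsto (fun n => lam ((hX n).add (hP n)) (outlierPos n θ i₀)) atTop (𝓝 ρ) := by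
  have hae := ae_mem_Icc_edge h.spectralLimit.isCompact_support
  have hGρ : cauchyG μ ρ * θ i₀ = 1 := by rw [hG, one_div_mul_cancel (h.ne_zero i₀)]
  rw [Set.mem_Icc, not_and_or, not_le, not_le] at hρ
  rcases hρ with hρ | hρ
  · have hi₀ : θ i₀ < 0 := one_div_neg.1 (hG ▸ cauchyG_neg hae hρ)
    have hanti := strictAntiOn_cauchyG_Iio hae
    refine tendsto_of_eventually_le_of_dense (Iio_mem_nhds hρ) hZ
      (fun z hzZ hz hzρ => h.eventually_le_lam_of_neg hP hθ hi₀ hzZ hz ?_)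
      (fun z hzZ hz hρz => h.eventually_lam_le_of_neg hP hθ hi₀ hzZ hz ?_)
    · exact (mul_lt_mul_of_neg_right (hanti hz hρ hzρ) hi₀).trans_eq hGρ
    · exact hGρ.symm.trans_lt (mul_lt_mul_of_neg_right (hanti hρ hz hρz) hi₀)
  · have hi₀ : 0 < θ i₀ := one_div_pos.1 (hG ▸ cauchyG_pos hae hρ)
    have hanti := strictAntiOn_cauchyG_Ioi hae
    refine tendsto_of_eventually_le_of_dense (Ioi_mem_nhds hρ) hZ
      (fun z hzZ hz hzρ => h.eventually_le_lam_of_pos hP hθ hi₀ hzZ hz ?_)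
      (fun z hzZ hz hρz => h.eventually_lam_le_of_pos hP hθ hi₀ hzZ hz ?_)
    · exact hGρ.symm.trans_lt (mul_lt_mul_of_pos_right (hanti hz hρ hzρ) hi₀)
    · exact (mul_lt_mul_of_pos_right (hanti hρ hz hρz) hi₀).trans_eq hGρ

end IsSpikedPath

end OutlierLocation

section EigenvectorLimits

theorem mul_norm_le_norm_toEuclideanLin_sub {𝕜 : Type*} [RCLike 𝕜] {n : ℕ}
    {A : Matrix (Fin n) (Fin n) 𝕜} (hA : A.IsHermitian) {δ z : ℝ} (hδ : 0 ≤ δ)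
    (h : ∀ i, δ ≤ |z - hA.eigenvalues i|) (u : EuclideanSpace 𝕜 (Fin n)) :
    δ * ‖u‖ ≤ ‖toEuclideanLin (algebraMap ℝ _ z - A) u‖ := by
  refine le_of_sq_le_sq ?_ (norm_nonneg _)
  rw [mul_pow, ← hA.eigenvectorBasis.sum_sq_norm_inner_right u,
    ← hA.eigenvectorBasis.sum_sq_norm_inner_right (toEuclideanLin _ u), Finset.mul_sum]
  refine Finset.sum_le_sum fun i _ => ?_
  rw [map_sub, LinearMap.sub_apply, toEuclideanLin_algebraMap_apply, inner_sub_right,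
    inner_smul_right, (hasSpectralExpansion_eigenvectorBasis hA).inner_apply, ← sub_mul, norm_mul,
    mul_pow, ← RCLike.ofReal_sub, RCLike.norm_ofReal]
  gcongr
  exact h i

variable {𝕜 : Type*} [RCLike 𝕜] {r : ℕ} {X P : (n : ℕ) → Matrix (Fin n) (Fin n) 𝕜}
  {hX : ∀ n, (X n).IsHermitian} {μ : Measure ℝ}

theorem IsSpectralLimit.exists_eventually_norm_resolvent_le (h : IsSpectralLimit hX μ) {z : ℝ}
    (hz : z ∉ Set.Icc (edgeInf μ) (edgeSup μ)) : ∃ C, ∀ᶠ n in atTop,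
      ∀ u : EuclideanSpace 𝕜 (Fin n), ‖toEuclideanLin (resolvent (X n) z) u‖ ≤ C * ‖u‖ := by
  obtain ⟨a, b, ha, hb, hzab⟩ := exists_notMem_Icc_enlarged hz
  obtain ⟨δ, hδ, hgap⟩ := exists_pos_le_abs_sub hzab
  refine ⟨δ⁻¹, ?_⟩
  filter_upwards [h.eventually_eigenvalues_mem ha hb, h.eventually_notMem_spectrum hz]
    with n hn hspec u
  have hle := mul_norm_le_norm_toEuclideanLin_sub (hX n) hδ.le (fun i => hgap _ (hn i))
    (toEuclideanLin (resolvent (X n) z) u)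
  rwa [toEuclideanLin_sub_apply_resolvent hspec, ← le_inv_mul_iff₀ hδ] at hle

theorem tendsto_mul_sub_zero {c m : ℕ → 𝕜} {a : 𝕜} {C : ℝ} (hc : ∀ᶠ n in atTop, ‖c n‖ ≤ C)
    (hm : Tendsto m atTop (𝓝 a)) : Tendsto (fun n => c n * m n - c n * a) atTop (𝓝 0) := by
  simp only [← mul_sub]
  exact isBoundedUnder_le_mul_tendsto_zero (isBoundedUnder_of_eventually_le hc)
    (tendsto_sub_nhds_zero_iff.2 hm)

namespace IsSpikedPath

variable {θ : Fin r → ℝ} {v : (n : ℕ) → Fin r → EuclideanSpace 𝕜 (Fin n)} {Z : Set ℝ} {ρ : ℝ}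
  {i₀ : Fin r} {u : (n : ℕ) → EuclideanSpace 𝕜 (Fin n)} {w : ℕ → ℝ}

theorem norm_inner_le_one (h : IsSpikedPath hX P μ θ v Z) {n : ℕ} (hn : r ≤ n) (j : Fin r)
    {x : EuclideanSpace 𝕜 (Fin n)} (hx : ‖x‖ = 1) : ‖⟪v n j, x⟫_𝕜‖ ≤ 1 := by
  have hle := norm_inner_le_norm (𝕜 := 𝕜) (v n j) x
  rwa [(h.expansion n hn).orthonormal.1, hx, one_mul] at hle

theorem tendsto_norm_sub_resolvent (h : IsSpikedPath hX P μ θ v Z)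
    (hρ : ρ ∉ Set.Icc (edgeInf μ) (edgeSup μ)) (hw : Tendsto w atTop (𝓝 ρ))
    (hu : ∀ n, r ≤ n → ‖u n‖ = 1 ∧ toEuclideanLin (X n + P n) (u n) = (w n : 𝕜) • u n) :
    Tendsto (fun n => ‖u n - toEuclideanLin (resolvent (X n) ρ) (toEuclideanLin (P n) (u n))‖)
      atTop (𝓝 0) := by
  obtain ⟨C, hC⟩ := h.spectralLimit.exists_eventually_norm_resolvent_le hρ
  have hlim : Tendsto (fun n => |ρ - w n| * C) atTop (𝓝 0) := by
    simpa using (hw.const_sub ρ).abs.mul_const C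
  refine squeeze_zero' (Eventually.of_forall fun _ => norm_nonneg _) ?_ hlim
  filter_upwards [hC, h.spectralLimit.eventually_notMem_spectrum hρ, eventually_ge_atTop r]
    with n hCn hspec hn
  obtain ⟨hnorm, heig⟩ := hu n hn
  have hshift : toEuclideanLin (algebraMap ℝ _ ρ - X n) (u n) =
      toEuclideanLin (P n) (u n) + ((ρ - w n : ℝ) : 𝕜) • u n := by
    rw [map_add, LinearMap.add_apply, ← eq_sub_iff_add_eq] at heig
    rw [map_sub, LinearMap.sub_apply, toEuclideanLin_algebraMap_apply, heig, RCLike.ofReal_sub,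
      sub_smul]
    abel
  have herr : u n - toEuclideanLin (resolvent (X n) ρ) (toEuclideanLin (P n) (u n)) =
      ((ρ - w n : ℝ) : 𝕜) • toEuclideanLin (resolvent (X n) ρ) (u n) := by
    rw [sub_eq_iff_eq_add', ← map_smul, ← map_add, ← hshift,
      toEuclideanLin_resolvent_apply_sub hspec]
  rw [herr, norm_smul, RCLike.norm_ofReal]
  gcongr
  simpa only [hnorm, mul_one] using hCn (u n)

theorem eventually_inner_norm_le (h : IsSpikedPath hX P μ θ v Z)
    (hu : ∀ n, r ≤ n → ‖u n‖ = 1) (j : Fin r) :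
    ∀ᶠ n in atTop, ‖(θ j : 𝕜) * ⟪v n j, u n⟫_𝕜‖ ≤ |θ j| := by
  filter_upwards [eventually_ge_atTop r] with n hn
  rw [norm_mul, RCLike.norm_ofReal]
  exact mul_le_of_le_one_right (abs_nonneg _) (h.norm_inner_le_one hn j (hu n hn))

variable [IsProbabilityMeasure μ]

theorem tendsto_inner_of_ne (h : IsSpikedPath hX P μ θ v Z) (hρZ : ρ ∈ Z)
    (hρ : ρ ∉ Set.Icc (edgeInf μ) (edgeSup μ)) (hG : cauchyG μ ρ = 1 / θ i₀)
    (hw : Tendsto w atTop (𝓝 ρ))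
    (hu : ∀ n, r ≤ n → ‖u n‖ = 1 ∧ toEuclideanLin (X n + P n) (u n) = (w n : 𝕜) • u n)
    {i : Fin r} (hi : θ i ≠ θ i₀) : Tendsto (fun n => ⟪v n i, u n⟫_𝕜) atTop (𝓝 0) := by
  have herr : Tendsto (fun n => ⟪v n i, u n - toEuclideanLin (resolvent (X n) ρ)
      (toEuclideanLin (P n) (u n))⟫_𝕜) atTop (𝓝 0) := by
    refine squeeze_zero_norm' ?_ (h.tendsto_norm_sub_resolvent hρ hw hu)
    filter_upwards [eventually_ge_atTop r] with n hn
    exact (norm_inner_le_norm _ _).trans_eq (by rw [(h.expansion n hn).orthonormal.1, one_mul])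
  have hmain := tendsto_finsetSum Finset.univ fun j _ => tendsto_mul_sub_zero
    (h.eventually_inner_norm_le (fun n hn => (hu n hn).1) j)
    (h.tendsto_inner_resolvent_pow hρZ hρ 1 i j)
  have hfac : (1 - θ i * cauchyG μ ρ : 𝕜) ≠ 0 := by
    rw [hG, ← RCLike.ofReal_mul, ← RCLike.ofReal_one, ← RCLike.ofReal_sub, RCLike.ofReal_ne_zero,
      sub_ne_zero, mul_one_div, ne_comm, Ne, div_eq_one_iff_eq (h.ne_zero i₀)]
    exact hi
  have hlim := (herr.add hmain).const_mul (1 - θ i * cauchyG μ ρ : 𝕜)⁻¹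
  rw [Finset.sum_const_zero, add_zero, mul_zero] at hlim
  refine hlim.congr' ?_
  filter_upwards [eventually_ge_atTop r] with n hn
  rw [inv_mul_eq_iff_eq_mul₀ hfac, (h.expansion n hn).apply_eq_sum]
  simp only [map_sum, map_smul, inner_sub_right, inner_sum, inner_smul_right, pow_one,
    resolventMoment_one, Finset.sum_sub_distrib, mul_ite, mul_zero, Finset.sum_ite_eq,
    Finset.mem_univ, if_true]
  ring

theorem tendsto_norm_resolvent_sq_sub (h : IsSpikedPath hX P μ θ v Z) (hρZ : ρ ∈ Z)
    (hρ : ρ ∉ Set.Icc (edgeInf μ) (edgeSup μ)) (hu : ∀ n, r ≤ n → ‖u n‖ = 1) :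
    Tendsto (fun n => ‖toEuclideanLin (resolvent (X n) ρ) (toEuclideanLin (P n) (u n))‖ ^ 2 -
      resolventMoment μ 2 ρ * ∑ j, θ j ^ 2 * ‖⟪v n j, u n⟫_𝕜‖ ^ 2) atTop (𝓝 0) := by
  have hbound (i j : Fin r) : ∀ᶠ n in atTop, ‖starRingEnd 𝕜 ((θ i : 𝕜) * ⟪v n i, u n⟫_𝕜) *
      ((θ j : 𝕜) * ⟪v n j, u n⟫_𝕜)‖ ≤ |θ i| * |θ j| := by
    filter_upwards [h.eventually_inner_norm_le hu i, h.eventually_inner_norm_le hu j] with n hi hj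
    rw [norm_mul, RCLike.norm_conj]
    gcongr
  have hlim := (RCLike.continuous_re.tendsto (0 : 𝕜)).comp (by
    simpa only [Finset.sum_const_zero] using tendsto_finsetSum Finset.univ fun i _ =>
      tendsto_finsetSum Finset.univ fun j _ => tendsto_mul_sub_zero (hbound i j)
        (h.tendsto_inner_resolvent_pow hρZ hρ 2 i j))
  rw [map_zero] at hlim
  refine hlim.congr' ?_
  filter_upwards [eventually_ge_atTop r] with n hn
  have hsymm := isSymmetric_toEuclideanLin_iff.2 (isHermitian_resolvent (hX n) ρ)
  have hsq : ‖toEuclideanLin (resolvent (X n) ρ) (toEuclideanLin (P n) (u n))‖ ^ 2 =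
      RCLike.re (∑ i, ∑ j, starRingEnd 𝕜 ((θ i : 𝕜) * ⟪v n i, u n⟫_𝕜) *
        ((θ j : 𝕜) * ⟪v n j, u n⟫_𝕜) *
          ⟪v n i, toEuclideanLin (resolvent (X n) ρ ^ 2) (v n j)⟫_𝕜) := by
    rw [← inner_sum_smul_apply, ← (h.expansion n hn).apply_eq_sum, sq (resolvent _ _),
      toLpLin_mul_same, LinearMap.comp_apply, ← hsymm, inner_self_eq_norm_sq]
  rw [hsq, Function.comp_apply]
  simp only [Finset.sum_sub_distrib, map_sub, map_sum,
    re_conj_mul_mul_ite (fun j => (θ j : 𝕜) * ⟪v n j, u n⟫_𝕜) fun _ => resolventMoment μ 2 ρ,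
    Finset.sum_ite_eq, Finset.mem_univ, if_true, norm_mul, RCLike.norm_ofReal, mul_pow, sq_abs,
    Finset.mul_sum]

theorem tendsto_sum_norm_inner_sq (h : IsSpikedPath hX P μ θ v Z) (hρZ : ρ ∈ Z)
    (hρ : ρ ∉ Set.Icc (edgeInf μ) (edgeSup μ)) (hw : Tendsto w atTop (𝓝 ρ))
    (hu : ∀ n, r ≤ n → ‖u n‖ = 1 ∧ toEuclideanLin (X n + P n) (u n) = (w n : 𝕜) • u n) :
    Tendsto (fun n => ∑ j, θ j ^ 2 * ‖⟪v n j, u n⟫_𝕜‖ ^ 2) atTop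
      (𝓝 (resolventMoment μ 2 ρ)⁻¹) := by
  have hpos := resolventMoment_two_pos (ae_mem_Icc_edge h.spectralLimit.isCompact_support) hρ
  have hnorm : Tendsto
      (fun n => ‖toEuclideanLin (resolvent (X n) ρ) (toEuclideanLin (P n) (u n))‖) atTop (𝓝 1) := by
    rw [tendsto_iff_norm_sub_tendsto_zero]
    refine squeeze_zero' (Eventually.of_forall fun _ => norm_nonneg _) ?_
      (h.tendsto_norm_sub_resolvent hρ hw hu)
    filter_upwards [eventually_ge_atTop r] with n hn
    rw [← (hu n hn).1, norm_sub_rev]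
    exact abs_norm_sub_norm_le _ _
  have hlim := ((hnorm.pow 2).sub (h.tendsto_norm_resolvent_sq_sub hρZ hρ
    fun n hn => (hu n hn).1)).const_mul (resolventMoment μ 2 ρ)⁻¹
  simpa only [sub_sub_cancel, inv_mul_cancel_left₀ hpos.ne', one_pow, sub_zero, mul_one] using hlim

theorem tendsto_projNorm_iSup_eigKer (h : IsSpikedPath hX P μ θ v Z) (hρZ : ρ ∈ Z)
    (hρ : ρ ∉ Set.Icc (edgeInf μ) (edgeSup μ)) (hG : cauchyG μ ρ = 1 / θ i₀)
    (hw : Tendsto w atTop (𝓝 ρ))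
    (hu : ∀ n, r ≤ n → ‖u n‖ = 1 ∧ toEuclideanLin (X n + P n) (u n) = (w n : 𝕜) • u n) :
    Tendsto (fun n => projNorm (u n) (⨆ (i : Fin r) (_ : θ i ≠ θ i₀), eigKer (P n) (θ i)))
      atTop (𝓝 0) := by
  have hlim := (tendsto_finsetSum (Finset.univ.filter fun j => θ j ≠ θ i₀) fun j hj =>
    (h.tendsto_inner_of_ne hρZ hρ hG hw hu (Finset.mem_filter.1 hj).2).norm.pow 2).sqrt
  simp only [norm_zero, zero_pow two_ne_zero, Finset.sum_const_zero, Real.sqrt_zero] at hlim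
  refine hlim.congr' ?_
  filter_upwards [eventually_ge_atTop r] with n hn
  rw [← projNorm_iSup_eigKer_sq (h.expansion n hn) h.ne_zero]
  exact Real.sqrt_sq (norm_nonneg _)

theorem tendsto_projNorm_eigKer_sq (h : IsSpikedPath hX P μ θ v Z) (hρZ : ρ ∈ Z)
    (hρ : ρ ∉ Set.Icc (edgeInf μ) (edgeSup μ)) (hG : cauchyG μ ρ = 1 / θ i₀)
    (hw : Tendsto w atTop (𝓝 ρ))
    (hu : ∀ n, r ≤ n → ‖u n‖ = 1 ∧ toEuclideanLin (X n + P n) (u n) = (w n : 𝕜) • u n) :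
    Tendsto (fun n => projNorm (u n) (eigKer (P n) (θ i₀)) ^ 2) atTop
      (𝓝 (-1 / (θ i₀ ^ 2 * deriv (cauchyG μ) ρ))) := by
  have hother := tendsto_finsetSum (Finset.univ.filter fun j => θ j ≠ θ i₀) fun j hj =>
    ((h.tendsto_inner_of_ne hρZ hρ hG hw hu (Finset.mem_filter.1 hj).2).norm.pow 2).const_mul
      (θ j ^ 2)
  have hlim := ((h.tendsto_sum_norm_inner_sq hρZ hρ hw hu).sub hother).div_const (θ i₀ ^ 2)
  simp only [norm_zero, zero_pow two_ne_zero, mul_zero, Finset.sum_const_zero, sub_zero] at hlim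
  rw [(hasDerivAt_cauchyG (ae_mem_Icc_edge h.spectralLimit.isCompact_support) hρ).deriv, mul_neg,
    neg_div_neg_eq, one_div, mul_inv, mul_comm, ← div_eq_mul_inv]
  refine hlim.congr' ?_
  filter_upwards [eventually_ge_atTop r] with n hn
  rw [projNorm_eigKer_sq (h.expansion n hn) (h.ne_zero i₀), ← Finset.sum_filter_add_sum_filter_not
    Finset.univ (fun j => θ j = θ i₀), add_sub_cancel_right,
    div_eq_iff (pow_ne_zero _ (h.ne_zero i₀)), Finset.sum_mul]
  refine Finset.sum_congr rfl fun j hj => ?_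
  rw [(Finset.mem_filter.1 hj).2, mul_comm]

end IsSpikedPath

end EigenvectorLimits

section AlmostSure

variable {𝕜 : Type*} [RCLike 𝕜] {Ω : Type*} [MeasurableSpace Ω] {Pr : Measure Ω}
  [IsProbabilityMeasure Pr] {X P : (n : ℕ) → Ω → Matrix (Fin n) (Fin n) 𝕜} {r : ℕ}
  {θ : Fin r → ℝ}

theorem ae_tendsto_compression_resolvent (hXm : ∀ n, Measurable (X n))
    (hPm : ∀ n, Measurable (P n)) (hX : ∀ n ω, (X n ω).IsHermitian)
    (hP : ∀ n ω, (P n ω).IsHermitian)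
    (hPθ : ∀ n, r ≤ n → ∀ᵐ ω ∂Pr, NonzeroEigenvaluesAre (hP n ω) θ)
    (hindep : ∀ n, r ≤ n → IndepFun (X n) (P n) Pr)
    (hinv : ∀ n, r ≤ n → ConjInvariant Pr (X n) ∨ ConjInvariant Pr (P n)) (k : ℕ) (z : ℝ) :
    ∀ᵐ ω ∂Pr, Tendsto (fun n => compression (resolvent (X n ω) z ^ k) (P n ω)) atTop (𝓝 0) := by
  have hmeas (n : ℕ) :
      Measurable fun A : Matrix (Fin n) (Fin n) 𝕜 => resolvent A z ^ k :=
    (continuous_pow k).measurable.comp (measurable_resolvent z)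
  refine ae_tendsto_compression (X := fun n ω => resolvent (X n ω) z ^ k)
    (S := √(∑ i, θ i ^ 2)) (fun n => (hmeas n).comp (hXm n)) hPm
    (fun n ω => (isHermitian_resolvent (hX n ω) z).pow k) hP
    (fun n hn => (hindep n hn).comp (hmeas n) measurable_id)
    (fun n hn => (hinv n hn).imp_left fun h => h.comp (hXm n) (hmeas n) fun U A => ?_)
    (fun n hn => ?_)
  · rw [resolvent_conj, map_pow]
  · filter_upwards [hPθ n hn] with ω hω
    exact Real.le_sqrt_of_sq_le hω.frobenius_norm_sq.le

theorem ae_exists_isSpikedPath {μ : Measure ℝ} (hXm : ∀ n, Measurable (X n))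
    (hPm : ∀ n, Measurable (P n)) {hX : ∀ n ω, (X n ω).IsHermitian}
    {hP : ∀ n ω, (P n ω).IsHermitian} (hlim : ∀ᵐ ω ∂Pr, IsSpectralLimit (fun n => hX n ω) μ)
    (hθ : ∀ i, θ i ≠ 0) (hPθ : ∀ n, r ≤ n → ∀ᵐ ω ∂Pr, NonzeroEigenvaluesAre (hP n ω) θ)
    (hindep : ∀ n, r ≤ n → IndepFun (X n) (P n) Pr)
    (hinv : ∀ n, r ≤ n → ConjInvariant Pr (X n) ∨ ConjInvariant Pr (P n)) {Z : Set ℝ}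
    (hZ : Z.Countable) :
    ∀ᵐ ω ∂Pr, ∃ v, IsSpikedPath (fun n => hX n ω) (fun n => P n ω) μ θ v Z := by
  have hcomp : ∀ᵐ ω ∂Pr, ∀ k, ∀ z ∈ Z,
      Tendsto (fun n => compression (resolvent (X n ω) z ^ k) (P n ω)) atTop (𝓝 0) :=
    ae_all_iff.2 fun k => (ae_ball_iff hZ).2 fun z _ =>
      ae_tendsto_compression_resolvent hXm hPm hX hP hPθ hindep hinv k z
  have hev : ∀ᵐ ω ∂Pr, ∀ n, r ≤ n → NonzeroEigenvaluesAre (hP n ω) θ :=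
    ae_all_iff.2 fun n => eventually_imp_distrib_left.2 (hPθ n)
  filter_upwards [hlim, hcomp, hev] with ω hω hcompω hevω
  have hex (n : ℕ) : ∃ v : Fin r → EuclideanSpace 𝕜 (Fin n),
      r ≤ n → HasSpectralExpansion (toEuclideanLin (P n ω)) θ v := by
    by_cases hn : r ≤ n
    · exact (hevω n hn).exists_hasSpectralExpansion.imp fun _ hv _ => hv
    · exact ⟨0, fun h => absurd h hn⟩
  choose v hv using hex
  exact ⟨v, hω, hθ, hv, hcompω⟩

end AlmostSure

end SpikedModel

end

theorem theorem2p2 {𝕜 : Type*} [RCLike 𝕜]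
    {Ω : Type*} [MeasurableSpace Ω] (Pr : Measure Ω) [IsProbabilityMeasure Pr]
    -- the random matrix `X n`
    (X : (n : ℕ) → Ω → Matrix (Fin n) (Fin n) 𝕜)
    (hXm : ∀ n, Measurable (X n))
    (hX : ∀ n ω, (X n ω).IsHermitian)
    -- the limiting spectral distribution and the convergence of the extreme eigenvalues
    (μX : Measure ℝ) [IsProbabilityMeasure μX] (hμX : IsCompact μX.support)
    (hweak : ∀ᵐ ω ∂Pr, SpikedModel.WeaklyConverges
      (fun n => SpikedModel.empiricalSpectral (hX n ω)) μX)
    (hmax : ∀ᵐ ω ∂Pr, Tendsto (fun n => SpikedModel.lam (hX n ω) 1) atTop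
      (𝓝 (SpikedModel.edgeSup μX)))
    (hmin : ∀ᵐ ω ∂Pr, Tendsto (fun n => SpikedModel.lam (hX n ω) n) atTop
      (𝓝 (SpikedModel.edgeInf μX)))
    -- the perturbation `P n`, of rank `r` as soon as `n ≥ r`
    (r : ℕ) (θ : Fin r → ℝ) (hθ : Antitone θ) (hθ0 : ∀ i, θ i ≠ 0)
    (P : (n : ℕ) → Ω → Matrix (Fin n) (Fin n) 𝕜)
    (hPm : ∀ n, Measurable (P n))
    (hP : ∀ n ω, (P n ω).IsHermitian)
    (hPθ : ∀ n, r ≤ n → ∀ᵐ ω ∂Pr, SpikedModel.NonzeroEigenvaluesAre (hP n ω) θ)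
    -- independence and invariance
    (hindep : ∀ n, r ≤ n → IndepFun (X n) (P n) Pr)
    (hinv : ∀ n, r ≤ n → SpikedModel.ConjInvariant Pr (X n) ∨ SpikedModel.ConjInvariant Pr (P n))
    -- the index `i₀` and the unit eigenvectors `u n`
    (i₀ : Fin r)
    (hi₀ : ((1 / θ i₀ : ℝ) : EReal) ∈
      Set.Ioo (SpikedModel.cauchyAtInf μX) (SpikedModel.cauchyAtSup μX))
    (u : (n : ℕ) → Ω → EuclideanSpace 𝕜 (Fin n))
    (hu : ∀ n, r ≤ n → ∀ᵐ ω ∂Pr, ‖u n ω‖ = 1 ∧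
      Module.End.HasEigenvector (Matrix.toEuclideanLin (X n ω + P n ω))
        ((SpikedModel.lam ((hX n ω).add (hP n ω)) (SpikedModel.outlierPos n θ i₀) : ℝ) : 𝕜)
        (u n ω)) :
    ∃ ρ : ℝ,
      -- `ρ` is the unique preimage of `1 / θ i₀` under `G` outside `[a, b]`
      (ρ ∉ Set.Icc (SpikedModel.edgeInf μX) (SpikedModel.edgeSup μX) ∧
        SpikedModel.cauchyG μX ρ = 1 / θ i₀ ∧
        ∀ z ∉ Set.Icc (SpikedModel.edgeInf μX) (SpikedModel.edgeSup μX),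
          SpikedModel.cauchyG μX z = 1 / θ i₀ → z = ρ) ∧
      -- and the limit of the outlier
      (∀ᵐ ω ∂Pr, Tendsto
        (fun n => SpikedModel.lam ((hX n ω).add (hP n ω)) (SpikedModel.outlierPos n θ i₀))
        atTop (𝓝 ρ)) ∧
      -- the derivative in the limit below exists and does not vanish
      (DifferentiableAt ℝ (SpikedModel.cauchyG μX) ρ ∧ deriv (SpikedModel.cauchyG μX) ρ ≠ 0) ∧
      (∀ᵐ ω ∂Pr, Tendsto
        (fun n => SpikedModel.projNorm (u n ω) (SpikedModel.eigKer (P n ω) (θ i₀)) ^ 2)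
        atTop (𝓝 (-1 / (θ i₀ ^ 2 * deriv (SpikedModel.cauchyG μX) ρ)))) ∧
      (∀ᵐ ω ∂Pr, Tendsto
        (fun n => SpikedModel.projNorm (u n ω)
          (⨆ (i : Fin r) (_ : θ i ≠ θ i₀), SpikedModel.eigKer (P n ω) (θ i)))
        atTop (𝓝 0)) := by
  obtain ⟨ρ, hρ, hG, huniq⟩ := SpikedModel.exists_unique_cauchyG_eq hμX (hθ0 i₀) hi₀
  have hsupp := SpikedModel.ae_mem_Icc_edge hμX
  have hderiv := SpikedModel.hasDerivAt_cauchyG hsupp hρ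
  obtain ⟨Q, hQ, hQd⟩ := TopologicalSpace.exists_countable_dense ℝ
  have hlim : ∀ᵐ ω ∂Pr, SpikedModel.IsSpectralLimit (fun n => hX n ω) μX := by
    filter_upwards [hweak, hmax, hmin] with ω hw hb ha using ⟨hμX, hw, hb, ha⟩
  have hpath := SpikedModel.ae_exists_isSpikedPath hXm hPm hlim hθ0 hPθ hindep hinv (hQ.insert ρ)
  have hlam : ∀ᵐ ω ∂Pr, Tendsto (fun n =>
      SpikedModel.lam ((hX n ω).add (hP n ω)) (SpikedModel.outlierPos n θ i₀)) atTop (𝓝 ρ) := by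
    filter_upwards [hpath] with ω ⟨v, h⟩
    exact h.tendsto_lam_outlierPos (hP · ω) hθ (hQd.mono (Set.subset_insert ρ Q)) hρ hG
  have heig := ae_all_iff.2 fun n => eventually_imp_distrib_left.2 fun hn =>
    (hu n hn).mono fun _ h => And.intro h.1 h.2.apply_eq_smul
  refine ⟨ρ, ⟨hρ, hG, huniq⟩, hlam, ⟨hderiv.differentiableAt, ?_⟩, ?_, ?_⟩
  · exact hderiv.deriv ▸ neg_ne_zero.2 (SpikedModel.resolventMoment_two_pos hsupp hρ).ne'
  · filter_upwards [hpath, hlam, heig] with ω ⟨v, h⟩ hw hu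
    exact h.tendsto_projNorm_eigKer_sq (Set.mem_insert ρ Q) hρ hG hw hu
  · filter_upwards [hpath, hlam, heig] with ω ⟨v, h⟩ hw hu
    exact h.tendsto_projNorm_iSup_eigKer (Set.mem_insert ρ Q) hρ hG hw hu
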